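/- Let $n\ge 1$, let $d\ge 2$ be a real number, and let $X_1,\dots,X_n\in L^d(\Omega,\mathcal F,\mathbf P)$ be real independent identically distributed random variables on a probability space, nondegenerate (i.e. not almost surely constant). Write $\vec X=(X_1,\dots,X_n)$. Let $\mathrm M_n$ be the space of complex $n\times n$ matrices and $\mathrm H_n$ the real vector space of Hermitian ones; for $A\in\mathrm H_n$ let $\vec\lambda(A)=(\lambda_1\ge\dots\ge\lambda_n)$ be its eigenvalues with multiplicity. For $1\le r\le d$ let $\mu_r=\mathbf E X_1^r$, $\mu_0=1$, and define the cumulants $\kappa_r$ by $\mu_r=\sum_{\ell=0}^{r-1}\binom{r-1}{\ell}\mu_\ell\kappa_{r-\ell}$ (if the moment generating function exists near $0$, these are the coefficients in $\log\mathbf E e^{tX_1}=\sum_{r\ge1}\kappa_r t^r/r!$). Let $B_\ell$ be the complete Bell polynomials, $\sum_{\ell\ge0}B_\ell(x_1,\dots,x_\ell)\,t^\ell/\ell!=\exp\big(\sum_{j\ge1}x_jt^j/j!\big)$. For a partition $\vec\pi=(\pi_1\ge\dots\ge\pi_r)$ of an integer, in which $i$ has multiplicity $m_i$, put $\kappa_{\vec\pi}=\kappa_{\pi_1}\cdots\kappa_{\pi_r}$,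 $y_{\vec\pi}=\prod_{i\ge1}(i!)^{m_i}m_i!$ and $p_{\vec\pi}(\vec\lambda)=\prod_{j=1}^r(\lambda_1^{\pi_j}+\dots+\lambda_n^{\pi_j})$, which is $\prod_{j=1}^r\operatorname{tr}A^{\pi_j}$ for $\vec\lambda=\vec\lambda(A)$. (a) For $A\in\mathrm H_n$ the expectation below is finite, and $$\|A\|_{\vec X,d}=\Big(\frac{\mathbf E|\langle\vec X,\vec\lambda(A)\rangle|^d}{\Gamma(d+1)}\Big)^{1/d}$$ is a norm on $\mathrm H_n$. (b) Suppose that $d$ is an even integer and that the $X_i$ have a moment generating function $M(t)=\mathbf E e^{tX_i}$, finite for $t$ near $0$. Then, for every $A\in\mathrm H_n$, $M_\Lambda(t)=\prod_{i=1}^nM(\lambda_it)$ is the moment generating function of $\Lambda=\langle\vec X,\vec\lambda(A)\rangle$, and $\|A\|_{\vec X,d}^d=[t^d]M_\Lambda(t)$, the coefficient of $t^d$ in its power series at $0$. In particular, $\|A\|_{\vec X,d}^d$ is the value at $\vec\lambda(A)$ of a symmetric polynomial on $\mathbb R^n$, homogeneous of degree $d$, that is positive except at $0$. (c) If $d$ is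 an even integer, then for every $A\in\mathrm H_n$ $$\|A\|_{\vec X,d}^d=\frac1{d!}B_d(\kappa_1\operatorname{tr}A,\kappa_2\operatorname{tr}A^2,\dots,\kappa_d\operatorname{tr}A^d)=\sum_{\vec\pi\vdash d}\frac{\kappa_{\vec\pi}\,p_{\vec\pi}(\vec\lambda(A))}{y_{\vec\pi}}.$$ (d) The function $\vec x\mapsto\big(\mathbf E|\langle\vec X,\vec x\rangle|^d/\Gamma(d+1)\big)^{1/d}$ on $\mathbb R^n$ is Schur convex: its value at $\vec x$ is at most its value at $\vec y$ whenever $\vec y$ majorizes $\vec x$, i.e. whenever $\sum_{i=1}^nx_i=\sum_{i=1}^ny_i$ and, for each $1\le k\le n$, the sum of the $k$ largest entries of $\vec x$ is at most that of $\vec y$. In particular, $\|A\|_{\vec X,d}\le\|B\|_{\vec X,d}$ for $A,B\in\mathrm H_n$ such that $\vec\lambda(B)$ majorizes $\vec\lambda(A)$. (e) Let $d$ be an even integer. For a partition $\vec\pi=(\pi_1,\dots,\pi_r)$ of $d$ and $Z\in\mathrm M_n$ let $\mathrm T_{\vec\pi}(Z)$ be $1/\binom d{d/2}$ times the sum over the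 $\binom d{d/2}$ ways to place $d/2$ adjoints ${}^*$ among the $d$ copies of $Z$ in $$(\operatorname{tr}\underbrace{ZZ\cdots Z}_{\pi_1})(\operatorname{tr}\underbrace{ZZ\cdots Z}_{\pi_2})\cdots(\operatorname{tr}\underbrace{ZZ\cdots Z}_{\pi_r}).$$ Then $\mathrm T_{\vec\pi}(Z)$ is real, the sum below is nonnegative, and $$\|Z\|_{\vec X,d}=\Big(\sum_{\vec\pi\vdash d}\frac{\kappa_{\vec\pi}\mathrm T_{\vec\pi}(Z)}{y_{\vec\pi}}\Big)^{1/d}$$ is a norm on the complex vector space $\mathrm M_n$ whose restriction to $\mathrm H_n$ is the norm in (a). In particular, $\|Z\|_{\vec X,d}^d$ is a real polynomial in traces of words in $Z$ and $Z^*$; it is continuous, and positive for $Z\ne0$. -/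

import Mathlib

open MeasureTheory ProbabilityTheory
open scoped BigOperators Topology Matrix Nat

namespace RandomNorm

/-- `N` is a norm on the `𝕜`-vector space `E`. -/
structure IsNorm (𝕜 : Type*) {E : Type*} [NormedField 𝕜] [AddCommGroup E] [Module 𝕜 E]
    (N : E → ℝ) : Prop where
  nonneg : ∀ x, 0 ≤ N x
  eq_zero_iff : ∀ x, N x = 0 ↔ x = 0
  smul : ∀ (c : 𝕜) (x : E), N (c • x) = ‖c‖ * N x
  add_le : ∀ x y, N (x + y) ≤ N x + N y

/-- A continuous real function that is positive everywhere, except perhaps at `0`. -/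
def IsPositiveDefinite {E : Type*} [TopologicalSpace E] [Zero E] (f : E → ℝ) : Prop :=
  Continuous f ∧ ∀ x, x ≠ 0 → 0 < f x

/-- The real vector space of `n × n` complex Hermitian matrices. -/
abbrev Herm (n : ℕ) : Type := selfAdjoint (Matrix (Fin n) (Fin n) ℂ)

/-- The eigenvalues of a Hermitian matrix, with multiplicity, in nonincreasing order. -/
noncomputable def eig {n : ℕ} (A : Herm n) : Fin n → ℝ := fun i =>
  Matrix.IsHermitian.eigenvalues₀ (A := (A : Matrix (Fin n) (Fin n) ℂ)) A.2
    (Fin.cast (Fintype.card_fin n).symm i)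

section Probability

variable {Ω : Type*} [MeasurableSpace Ω]

/-- The random variable `⟨X, x⟩ = x₁ X₁ + ⋯ + xₙ Xₙ`. -/
def pairing {n : ℕ} (X : Fin n → Ω → ℝ) (x : Fin n → ℝ) : Ω → ℝ :=
  fun ω => ∑ i, X i ω * x i

/-- `(𝔼 |⟨X, x⟩|ᵈ / Γ(d + 1))^(1/d)`, as a function of `x ∈ ℝⁿ`. -/
noncomputable def vecNorm {n : ℕ} (P : Measure Ω) (X : Fin n → Ω → ℝ) (d : ℝ)
    (x : Fin n → ℝ) : ℝ :=
  ((∫ ω, |pairing X x ω| ^ d ∂P) / Real.Gamma (d + 1)) ^ (1 / d)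

/-- `(𝔼 |⟨X, λ(A)⟩|ᵈ / Γ(d + 1))^(1/d)`, for Hermitian `A`. -/
noncomputable def hermNorm {n : ℕ} (P : Measure Ω) (X : Fin n → Ω → ℝ) (d : ℝ)
    (A : Herm n) : ℝ :=
  vecNorm P X d (eig A)

/-- The cumulants `κ_r` of a random variable, in terms of its moments `μ_r`, through
`μ_r = ∑_{ℓ = 0}^{r - 1} (r - 1 choose ℓ) μ_ℓ κ_{r - ℓ}` for `r ≥ 1`, where `μ_0 = 1`
(and `κ_0 = 0`). The term `ℓ = 0` is `κ_r`; the others are indexed by `ℓ = j + 1`. -/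
noncomputable def cumulant (P : Measure Ω) (X : Ω → ℝ) : ℕ → ℝ
  | 0 => 0
  | r + 1 => moment X (r + 1) P -
      ∑ j : Fin r, (r.choose (j + 1) : ℝ) * moment X (j + 1) P * cumulant P X (r - j)
  decreasing_by omega

theorem moment_eq_sum_cumulant (P : Measure Ω) [IsProbabilityMeasure P] (X : Ω → ℝ)
    (r : ℕ) (hr : 1 ≤ r) :
    moment X r P = ∑ l ∈ Finset.range r,
      ((r - 1).choose l : ℝ) * moment X l P * cumulant P X (r - l) := by
  obtain ⟨r, rfl⟩ : ∃ s, r = s + 1 := ⟨r - 1, by omega⟩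
  have h0 : moment X 0 P = 1 := by simp [moment]
  have hc := cumulant.eq_def P X (r + 1)
  simp only at hc
  rw [Fin.sum_univ_eq_sum_range
    (fun j => (r.choose (j + 1) : ℝ) * moment X (j + 1) P * cumulant P X (r - j)) r] at hc
  rw [Finset.sum_range_succ']
  simp only [h0, Nat.choose_zero_right, Nat.cast_one, Nat.sub_zero, add_tsub_cancel_right,
    one_mul, Nat.add_sub_add_right]
  rw [hc]
  ring

/-- If the moment generating function is finite near `0`, then the cumulants are the Taylor
coefficients (times `r!`) at `0` of its logarithm. -/
theorem cumulant_eq_iteratedDeriv_cgf (P : Measure Ω) [IsProbabilityMeasure P] (X : Ω → ℝ)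
    (h : 0 ∈ interior (integrableExpSet X P)) (r : ℕ) :
    cumulant P X r = iteratedDeriv r (cgf X P) 0 := by
  induction r using Nat.strong_induction_on with
  | _ r ih =>
  rcases r with _ | r
  · simp [cumulant]
  have hmom : ∀ l, iteratedDeriv l (mgf X P) 0 = moment X l P := fun l => by
    rw [iteratedDeriv_mgf_zero h]; rfl
  have hev : deriv (mgf X P) =ᶠ[𝓝 0] mgf X P * deriv (cgf X P) := by
    filter_upwards [isOpen_interior.eventually_mem h] with t ht
    rw [Pi.mul_apply, deriv_cgf ht, deriv_mgf ht,
      mul_div_cancel₀ _ (mgf_pos (interior_subset (s := integrableExpSet X P) ht)).ne']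
  have hK : ∀ j, iteratedDeriv j (deriv (cgf X P)) 0 = iteratedDeriv (j + 1) (cgf X P) 0 :=
    fun j => by rw [iteratedDeriv_succ']
  have hM : iteratedDeriv (r + 1) (mgf X P) 0 = ∑ l ∈ Finset.range (r + 1),
      (r.choose l : ℝ) * moment X l P * iteratedDeriv (r - l + 1) (cgf X P) 0 := by
    rw [iteratedDeriv_succ', hev.iteratedDeriv_eq r,
      iteratedDeriv_mul (analyticAt_mgf h).contDiffAt (analyticAt_cgf h).deriv.contDiffAt]
    exact Finset.sum_congr rfl fun l _ => by rw [hmom, hK]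
  have hA := moment_eq_sum_cumulant P X (r + 1) (by omega)
  rw [hmom, hA, Finset.sum_range_succ', Finset.sum_range_succ'] at hM
  have hs : ∀ l ∈ Finset.range r,
      ((r + 1 - 1).choose (l + 1) : ℝ) * moment X (l + 1) P * cumulant P X (r + 1 - (l + 1)) =
      (r.choose (l + 1) : ℝ) * moment X (l + 1) P *
        iteratedDeriv (r - (l + 1) + 1) (cgf X P) 0 := fun l hl => by
    have hl' := Finset.mem_range.mp hl
    rw [ih (r + 1 - (l + 1)) (by omega)]
    congr 2
    omega
  rw [Finset.sum_congr rfl hs] at hM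
  have h0 : moment X 0 P = 1 := by simp [moment]
  simpa [h0] using hM

end Probability

/-- `f` is the sum of a power series near `0`, in which the coefficient of `t ^ k` is `a`:
`[t ^ k] f(t) = a`. -/
def HasPowerSeriesCoeff (f : ℝ → ℝ) (k : ℕ) (a : ℝ) : Prop :=
  ∃ c : ℕ → ℝ, (∀ᶠ t in 𝓝 (0 : ℝ), HasSum (fun j => c j * t ^ j) (f t)) ∧ c k = a

/-- The complete Bell polynomials `B_ℓ(x₁, …, x_ℓ)`, with values in a commutative `ℚ`-algebra:
`∑ B_ℓ(x₁, …, x_ℓ) t^ℓ / ℓ! = exp (∑_{j ≥ 1} x_j t^j / j!)`, as formal power series in `t`. -/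
noncomputable def bell {R : Type*} [CommRing R] [Algebra ℚ R] (ℓ : ℕ) (x : ℕ → R) : R :=
  (ℓ ! : R) * PowerSeries.coeff ℓ ((PowerSeries.exp R).subst
    (PowerSeries.mk fun j => if j = 0 then 0 else algebraMap ℚ R (1 / (j ! : ℚ)) * x j))

section Partitions

variable {d : ℕ}

/-- `κ_π = κ_{π₁} κ_{π₂} ⋯ κ_{π_r}`. -/
def kappaPart (κ : ℕ → ℝ) (π : Nat.Partition d) : ℝ := (π.parts.map κ).prod

/-- `y_π = ∏_{i ≥ 1} (i!)^{m_i} m_i!`, where `m_i` is the multiplicity of `i` in `π`. -/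
def yPart (π : Nat.Partition d) : ℕ :=
  ∏ i ∈ π.parts.toFinset, i ! ^ π.parts.count i * (π.parts.count i)!

/-- `p_π(x) = p_{π₁}(x) ⋯ p_{π_r}(x)`, where `p_k` is the `k`th power sum. -/
noncomputable def psumPart {n : ℕ} (π : Nat.Partition d) (x : Fin n → ℝ) : ℝ :=
  (π.parts.map fun k => ∑ i, x i ^ k).prod

/-- `T_π(Z)`, for `π = (π₁ ≥ π₂ ≥ ⋯ ≥ π_r)`: the sum of `(tr w₁)(tr w₂) ⋯ (tr w_r)`, divided by
`d choose d/2`, over all words `w₁ w₂ ⋯ w_r` of length `d` that have `Zᴴ` in a set `S` of `d / 2`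
places and `Z` in the others, cut into consecutive blocks of lengths `π₁, …, π_r`. -/
noncomputable def tracePart {n : ℕ} (π : Nat.Partition d) (Z : Matrix (Fin n) (Fin n) ℂ) : ℂ :=
  (∑ S ∈ Finset.powersetCard (d / 2) (Finset.univ : Finset (Fin d)),
    (((π.parts.sort (· ≥ ·)).splitLengths
      (List.ofFn fun i : Fin d => if i ∈ S then Zᴴ else Z)).map
        fun w => w.prod.trace).prod) / (d.choose (d / 2) : ℂ)

end Partitions

/-- `(∑_{π ⊢ d} κ_π T_π(Z) / y_π)^(1/d)` (the numbers `T_π(Z)` are real for even `d`). -/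
noncomputable def matNorm {n : ℕ} (κ : ℕ → ℝ) (d : ℕ) (Z : Matrix (Fin n) (Fin n) ℂ) : ℝ :=
  (∑ π : Nat.Partition d, kappaPart κ π * (tracePart π Z).re / (yPart π : ℝ)) ^ (1 / (d : ℝ))

/-- The value at `Z` of a word in the letters `x` (`true`) and `x*` (`false`). -/
noncomputable def evalWord {n : ℕ} (Z : Matrix (Fin n) (Fin n) ℂ) :
    FreeMonoid Bool →* Matrix (Fin n) (Fin n) ℂ :=
  FreeMonoid.lift fun b => if b then Z else Zᴴ

/-- `f(Z)` is a polynomial with real coefficients in traces of words in `Z` and `Zᴴ`. -/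
def IsTracePolynomial {n : ℕ} (f : Matrix (Fin n) (Fin n) ℂ → ℝ) : Prop :=
  ∃ q : MvPolynomial (FreeMonoid Bool) ℝ, ∀ Z,
    (f Z : ℂ) = MvPolynomial.aeval (fun w => (evalWord Z w).trace) q

/-- `∑_{i ≤ k} x̃_i`, where `x̃` is the nonincreasing rearrangement of `x`. -/
noncomputable def topSum {n : ℕ} (x : Fin n → ℝ) (k : ℕ) : ℝ :=
  ∑ i : Fin n with i.val < k, x (Tuple.sort x i.rev)

/-- `y` majorizes `x`. -/
def Majorizes {n : ℕ} (y x : Fin n → ℝ) : Prop :=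
  ∑ i, x i = ∑ i, y i ∧ ∀ k, 1 ≤ k → k ≤ n → topSum x k ≤ topSum y k

/-- Schur convexity: `f x ≤ f y` whenever `y` majorizes `x`. -/
def SchurConvex {n : ℕ} (f : (Fin n → ℝ) → ℝ) : Prop :=
  ∀ x y, Majorizes y x → f x ≤ f y

end RandomNorm

/-!
A combination of the `X i` is constant almost surely only if all its coefficients vanish, as these
variables are independent and not constant. Hence `x ↦ ⟨X, x⟩` embeds `ℝⁿ` into `L^d`, and
`vecNorm` is the norm pulled back along it; it does not change when the entries of `x` are permuted.

A norm `N` on `ℝⁿ` with this invariance is convex, so that `N x ≤ N y` for all `x` in the convex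
hull of the permutations of `y`. By Rado's theorem this hull contains all `x` that `y` majorizes. By
Birkhoff's theorem, it contains the diagonal of a Hermitian matrix in any orthonormal basis, if `y`
consists of the eigenvalues. Thus `N (λ(A))` is the maximum of `N (diag (Uᴴ A U))` over all unitary
`U`, and the triangle inequality for `A ↦ N (λ(A))` follows from that for `N`.

Moments are the complete Bell polynomials of the cumulants, and cumulants of independent variables
add up: the cumulants of `⟨X, x⟩` are `κ_j ∑ᵢ xᵢ^j`. The exponential formula expands the Bell
polynomial into a sum over partitions.

For the matrix norm, expand `tr (u Z + ū Zᴴ)^{π₁} ⋯ tr (u Z + ū Zᴴ)^{π_r}` into words and average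
over the `(d + 1)`st roots of unity `u`: only the words with `d / 2` adjoints survive. So, up to a
constant factor, `matNorm` is the `ℓ^d` norm of the values of the Hermitian norm at the matrices
`u Z + ū Zᴴ`.
-/

namespace RandomNorm

section Norm

variable {𝕜 E F : Type*} [NormedField 𝕜]

theorem isNorm_norm [NormedAddCommGroup E] [NormedSpace 𝕜 E] : IsNorm 𝕜 fun x : E => ‖x‖ :=
  ⟨norm_nonneg, fun _ => norm_eq_zero, norm_smul, norm_add_le⟩

variable [AddCommGroup E] [Module 𝕜 E] [AddCommGroup F] [Module 𝕜 F]

theorem IsNorm.comp_injective {N : F → ℝ} (hN : IsNorm 𝕜 N) {f : E →ₗ[𝕜] F}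
    (hf : Function.Injective f) : IsNorm 𝕜 fun x => N (f x) where
  nonneg x := hN.nonneg (f x)
  eq_zero_iff x := (hN.eq_zero_iff _).trans (map_eq_zero_iff f hf)
  smul c x := by rw [map_smul, hN.smul]
  add_le x y := by simpa only [map_add] using hN.add_le (f x) (f y)

theorem IsNorm.div_const {N : E → ℝ} (hN : IsNorm 𝕜 N) {c : ℝ} (hc : 0 < c) :
    IsNorm 𝕜 fun x => N x / c where
  nonneg x := div_nonneg (hN.nonneg x) hc.le
  eq_zero_iff x := by rw [div_eq_zero_iff, or_iff_left hc.ne', hN.eq_zero_iff]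
  smul a x := by rw [hN.smul, mul_div_assoc]
  add_le x y := by
    rw [← add_div]
    gcongr
    exact hN.add_le x y

theorem IsNorm.lpSum {ι : Type*} [Fintype ι] {N : E → ℝ} (hN : IsNorm 𝕜 N) {p : ℝ} (hp : 1 ≤ p) :
    IsNorm 𝕜 fun f : ι → E => (∑ i, N (f i) ^ p) ^ (1 / p) := by
  have hp0 : 0 < p := one_pos.trans_le hp
  have hterm : ∀ (f : ι → E) i, 0 ≤ N (f i) ^ p := fun f i => Real.rpow_nonneg (hN.nonneg _) _
  have hsum : ∀ f : ι → E, 0 ≤ ∑ i, N (f i) ^ p := fun f => Finset.sum_nonneg fun i _ => hterm f i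
  refine ⟨fun f => Real.rpow_nonneg (hsum f) _, fun f => ?_, fun c f => ?_, fun f g => ?_⟩
  · rw [Real.rpow_eq_zero (hsum f) (one_div_ne_zero hp0.ne'),
      Finset.sum_eq_zero_iff_of_nonneg fun i _ => hterm f i, funext_iff]
    simp only [Finset.mem_univ, true_imp_iff, Real.rpow_eq_zero (hN.nonneg _) hp0.ne',
      hN.eq_zero_iff, Pi.zero_apply]
  · simp only [Pi.smul_apply, hN.smul, Real.mul_rpow (norm_nonneg c) (hN.nonneg _),
      ← Finset.mul_sum]
    rw [Real.mul_rpow (by positivity) (hsum f), one_div, Real.rpow_rpow_inv (norm_nonneg c) hp0.ne']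
  · calc (∑ i, N (f i + g i) ^ p) ^ (1 / p)
        ≤ (∑ i, (N (f i) + N (g i)) ^ p) ^ (1 / p) := by
          refine Real.rpow_le_rpow (hsum (f + g)) (Finset.sum_le_sum fun i _ => ?_) (by positivity)
          exact Real.rpow_le_rpow (hN.nonneg _) (hN.add_le _ _) hp0.le
      _ ≤ _ := Real.Lp_add_le_of_nonneg _ hp (fun i _ => hN.nonneg _) fun i _ => hN.nonneg _

theorem IsNorm.pos {N : E → ℝ} (hN : IsNorm 𝕜 N) {x : E} (hx : x ≠ 0) : 0 < N x :=
  (hN.nonneg x).lt_of_ne' (mt (hN.eq_zero_iff x).1 hx)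

theorem IsNorm.isPositiveDefinite_pow [TopologicalSpace E] {N : E → ℝ} (hN : IsNorm 𝕜 N) {m : ℕ}
    (hc : Continuous fun x => N x ^ m) : IsPositiveDefinite fun x => N x ^ m :=
  ⟨hc, fun _ hx => pow_pos (hN.pos hx) m⟩

theorem IsNorm.convexOn {E : Type*} [AddCommGroup E] [Module ℝ E] {N : E → ℝ}
    (hN : IsNorm ℝ N) : ConvexOn ℝ Set.univ N := by
  refine ⟨convex_univ, fun x _ y _ a b ha hb _ => (hN.add_le _ _).trans ?_⟩
  rw [hN.smul, hN.smul, Real.norm_of_nonneg ha, Real.norm_of_nonneg hb, smul_eq_mul, smul_eq_mul]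

end Norm

section SymmetricNorm

variable {ι : Type*}

/-- Invariance of a function of a real vector under permutations of the entries. -/
def IsPermInvariant (f : (ι → ℝ) → ℝ) : Prop :=
  ∀ (σ : Equiv.Perm ι) x, f (x ∘ σ) = f x

/-- The permutohedron of `x`: the convex hull of the vectors obtained from `x` by permuting its
entries. -/
def permutohedron (x : ι → ℝ) : Set (ι → ℝ) :=
  convexHull ℝ (Set.range fun σ : Equiv.Perm ι => x ∘ σ)

theorem IsNorm.le_of_mem_permutohedron {N : (ι → ℝ) → ℝ} (hN : IsNorm ℝ N)
    (hperm : IsPermInvariant N) {x y : ι → ℝ} (h : y ∈ permutohedron x) : N y ≤ N x := by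
  have hsub : Set.range (fun σ : Equiv.Perm ι => x ∘ σ) ⊆ {z | z ∈ Set.univ ∧ N z ≤ N x} := by
    rintro _ ⟨σ, rfl⟩
    exact ⟨trivial, (hperm σ x).le⟩
  exact (convexHull_min hsub (hN.convexOn.convex_le (N x)) h).2

theorem mulVec_mem_permutohedron [Fintype ι] [DecidableEq ι] {M : Matrix ι ι ℝ}
    (hM : M ∈ doublyStochastic ℝ ι) (x : ι → ℝ) : M *ᵥ x ∈ permutohedron x := by
  -- Birkhoff's theorem, mapped by `M ↦ M x`
  have hM' : M ∈ (doublyStochastic ℝ ι : Set (Matrix ι ι ℝ)) := hM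
  rw [doublyStochastic_eq_convexHull_permMatrix] at hM'
  have hx := Set.mem_image_of_mem ((Matrix.mulVecBilin ℝ ℝ).flip x) hM'
  rw [LinearMap.image_convexHull] at hx
  refine convexHull_mono ?_ hx
  rintro _ ⟨_, ⟨σ, rfl⟩, rfl⟩
  exact ⟨σ, (Matrix.permMatrix_mulVec σ).symm⟩

end SymmetricNorm

section Majorization

variable {n : ℕ}

/-- The permutation that sorts the entries of `x` in nonincreasing order (`Tuple.sort` sorts them in
nondecreasing order). -/
noncomputable def sortDesc (x : Fin n → ℝ) : Equiv.Perm (Fin n) :=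
  Fin.revPerm.trans (Tuple.sort x)

theorem antitone_comp_sortDesc (x : Fin n → ℝ) : Antitone (x ∘ sortDesc x) :=
  fun _ _ h => Tuple.monotone_sort x (Fin.rev_le_rev.2 h)

theorem topSum_succ_eq_sum_Iic (x : Fin n → ℝ) (k : Fin n) :
    topSum x (k + 1) = ∑ i ∈ Finset.Iic k, x (sortDesc x i) := by
  refine Finset.sum_congr ?_ fun _ _ => rfl
  ext i
  simp

theorem mul_sum_le_sum_mul_of_antitone {a z : Fin (n + 1) → ℝ} (ha : Antitone a)
    (hz : ∀ k, 0 ≤ ∑ i ∈ Finset.Iic k, z i) :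
    a (Fin.last n) * ∑ i, z i ≤ ∑ i, a i * z i := by
  induction n with
  | zero => simp
  | succ n ih =>
    have hz' : ∀ k : Fin (n + 1), 0 ≤ ∑ i ∈ Finset.Iic k, z i.castSucc := fun k => by
      simpa only [Fin.sum_Iic_castSucc] using hz k.castSucc
    have hsum : 0 ≤ ∑ i : Fin (n + 1), z i.castSucc := by
      simpa [← Fin.top_eq_last] using hz' (Fin.last n)
    calc a (Fin.last _) * ∑ i, z i
        = a (Fin.last _) * ∑ i : Fin (n + 1), z i.castSucc + a (Fin.last _) * z (Fin.last _) := by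
          rw [Fin.sum_univ_castSucc, mul_add]
      _ ≤ a (Fin.last n).castSucc * ∑ i : Fin (n + 1), z i.castSucc
            + a (Fin.last _) * z (Fin.last _) := by
          gcongr
          exact ha (Fin.le_last _)
      _ ≤ ∑ i : Fin (n + 1), a i.castSucc * z i.castSucc + a (Fin.last _) * z (Fin.last _) := by
          gcongr
          exact ih (ha.comp_monotone Fin.strictMono_castSucc.monotone) hz'
      _ = ∑ i, a i * z i := (Fin.sum_univ_castSucc fun i => a i * z i).symm

theorem Majorizes.sum_mul_sortDesc_le {x y : Fin n → ℝ} (h : Majorizes y x) {a : Fin n → ℝ}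
    (ha : Antitone a) : ∑ i, a i * x (sortDesc x i) ≤ ∑ i, a i * y (sortDesc y i) := by
  rcases n with _ | n
  · simp
  let z : Fin (n + 1) → ℝ := fun i => y (sortDesc y i) - x (sortDesc x i)
  have hz : ∀ k, 0 ≤ ∑ i ∈ Finset.Iic k, z i := fun k => by
    rw [Finset.sum_sub_distrib, sub_nonneg, ← topSum_succ_eq_sum_Iic, ← topSum_succ_eq_sum_Iic]
    exact h.2 _ (Nat.le_add_left _ _) k.2
  have hsum : ∑ i, z i = 0 := by
    rw [Finset.sum_sub_distrib, Equiv.sum_comp, Equiv.sum_comp, h.1, sub_self]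
  have habel := mul_sum_le_sum_mul_of_antitone ha hz
  rw [hsum, mul_zero] at habel
  simpa only [z, mul_sub, Finset.sum_sub_distrib, sub_nonneg] using habel

theorem sum_mul_le_sum_sortDesc_mul (c x : Fin n → ℝ) :
    ∑ i, c i * x i ≤ ∑ i, c (sortDesc c i) * x (sortDesc x i) := by
  have hmono : Monovary (c ∘ sortDesc c) (x ∘ sortDesc x) :=
    (antitone_comp_sortDesc c).monovary (antitone_comp_sortDesc x)
  rw [← Equiv.sum_comp (sortDesc c)]
  simpa using hmono.sum_mul_comp_perm_le_sum_mul (σ := (sortDesc c).trans (sortDesc x).symm)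

/-- **Rado's theorem**, in one direction. -/
theorem Majorizes.mem_permutohedron {x y : Fin n → ℝ} (h : Majorizes y x) :
    x ∈ permutohedron y := by
  by_contra hx
  obtain ⟨f, u, hf, hu⟩ := geometric_hahn_banach_closed_point (convex_convexHull ℝ _)
    ((Set.finite_range fun σ : Equiv.Perm (Fin n) => y ∘ σ).isClosed_convexHull ℝ) hx
  let c : Fin n → ℝ := fun i => f fun j => if i = j then 1 else 0
  have hc : ∀ v, f v = ∑ i, c i * v i := fun v => by
    simpa [mul_comm] using f.toLinearMap.pi_apply_eq_sum_univ v
  let σ : Equiv.Perm (Fin n) := (sortDesc c).symm.trans (sortDesc y)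
  refine lt_irrefl (f x) ?_
  calc f x = ∑ i, c i * x i := hc x
    _ ≤ ∑ i, c (sortDesc c i) * x (sortDesc x i) := sum_mul_le_sum_sortDesc_mul c x
    _ ≤ ∑ i, c (sortDesc c i) * y (sortDesc y i) :=
        h.sum_mul_sortDesc_le (antitone_comp_sortDesc c)
    _ = ∑ i, c i * y (σ i) := Fintype.sum_equiv (sortDesc c) _ _ fun i => by simp [σ]
    _ = f (y ∘ σ) := (hc _).symm
    _ < u := hf _ (subset_convexHull ℝ _ ⟨σ, rfl⟩)
    _ < f x := hu

theorem IsNorm.schurConvex {N : (Fin n → ℝ) → ℝ} (hN : IsNorm ℝ N) (hperm : IsPermInvariant N) :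
    SchurConvex N :=
  fun _ _ h => hN.le_of_mem_permutohedron hperm h.mem_permutohedron

end Majorization

section Spectral

section UnitaryConjugation

variable {ι 𝕜 : Type*} [Fintype ι] [DecidableEq ι] [RCLike 𝕜]

theorem normSq_entries_mem_doublyStochastic {V : Matrix ι ι 𝕜}
    (hV : V ∈ Matrix.unitaryGroup ι 𝕜) :
    (Matrix.of fun i j => ‖V i j‖ ^ 2) ∈ doublyStochastic ℝ ι := by
  refine mem_doublyStochastic_iff_sum.2 ⟨fun i j => by simp, fun i => ?_, fun j => ?_⟩
  · have h := congrFun₂ (Matrix.mem_unitaryGroup_iff.1 hV) i i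
    simp only [Matrix.mul_apply, Matrix.star_apply, RCLike.star_def, RCLike.mul_conj,
      Matrix.one_apply_eq] at h
    exact_mod_cast h
  · have h := congrFun₂ (Matrix.mem_unitaryGroup_iff'.1 hV) j j
    simp only [Matrix.mul_apply, Matrix.star_apply, RCLike.star_def, RCLike.conj_mul,
      Matrix.one_apply_eq] at h
    exact_mod_cast h

/-- The real part of the diagonal of `Uᴴ A U`, linear in `A`. For unitary `U` and Hermitian `A`
this is the diagonal of `A` in the orthonormal basis of the columns of `U`. -/
def conjDiag (U : Matrix ι ι 𝕜) : Matrix ι ι 𝕜 →ₗ[ℝ] (ι → ℝ) where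
  toFun A i := RCLike.re ((star U * A * U) i i)
  map_add' A B := by ext i; simp [mul_add, add_mul]
  map_smul' c A := by ext i; simp [RCLike.smul_re]

theorem conjDiag_eigenvectorUnitary {A : Matrix ι ι 𝕜} (hA : A.IsHermitian) :
    conjDiag (hA.eigenvectorUnitary : Matrix ι ι 𝕜) A = hA.eigenvalues := by
  ext i
  have h := hA.conjStarAlgAut_star_eigenvectorUnitary
  simp only [Unitary.conjStarAlgAut_apply, Unitary.coe_star, star_star] at h
  simp [conjDiag, h]

theorem conjDiag_mem_permutohedron {A : Matrix ι ι 𝕜} (hA : A.IsHermitian) {U : Matrix ι ι 𝕜}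
    (hU : U ∈ Matrix.unitaryGroup ι 𝕜) : conjDiag U A ∈ permutohedron hA.eigenvalues := by
  set W : Matrix ι ι 𝕜 := hA.eigenvectorUnitary.1 with hW
  set V : Matrix ι ι 𝕜 := star U * W with hVdef
  have hV : V ∈ Matrix.unitaryGroup ι 𝕜 :=
    mul_mem (Unitary.star_mem hU) hA.eigenvectorUnitary.2
  have hdiag : star U * A * U = V * Matrix.diagonal (RCLike.ofReal ∘ hA.eigenvalues) * star V := by
    conv_lhs => rw [hA.spectral_theorem, Unitary.conjStarAlgAut_apply]
    simp [hVdef, hW, mul_assoc]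
  convert mulVec_mem_permutohedron (normSq_entries_mem_doublyStochastic hV) hA.eigenvalues
  ext i
  change RCLike.re ((star U * A * U) i i) = ∑ j, ‖V i j‖ ^ 2 * hA.eigenvalues j
  rw [hdiag, Matrix.mul_apply, map_sum]
  refine Finset.sum_congr rfl fun j _ => ?_
  rw [Matrix.mul_diagonal, Matrix.star_apply, mul_right_comm, RCLike.star_def, RCLike.mul_conj,
    Function.comp_apply]
  norm_cast

end UnitaryConjugation

variable {n : ℕ} {N : (Fin n → ℝ) → ℝ}

theorem Herm.isHermitian (A : Herm n) : (A : Matrix (Fin n) (Fin n) ℂ).IsHermitian := A.2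

theorem exists_eig_eq_eigenvalues_comp (A : Herm n) :
    ∃ σ : Equiv.Perm (Fin n), eig A = A.isHermitian.eigenvalues ∘ σ := by
  refine ⟨(finCongr (Fintype.card_fin n).symm).trans
    (Fintype.equivOfCardEq (Fintype.card_fin _)), ?_⟩
  ext i
  simp [eig, Matrix.IsHermitian.eigenvalues]

theorem IsPermInvariant.apply_eig (hperm : IsPermInvariant N) (A : Herm n) :
    N (eig A) = N A.isHermitian.eigenvalues := by
  obtain ⟨σ, hσ⟩ := exists_eig_eq_eigenvalues_comp A
  rw [hσ, hperm]

theorem IsNorm.isGreatest_apply_eig (hN : IsNorm ℝ N) (hperm : IsPermInvariant N) (A : Herm n) :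
    IsGreatest (Set.range fun U : Matrix.unitaryGroup (Fin n) ℂ => N (conjDiag U.1 A.1))
      (N (eig A)) := by
  rw [hperm.apply_eig]
  refine ⟨⟨A.isHermitian.eigenvectorUnitary, ?_⟩, ?_⟩
  · exact congrArg N (conjDiag_eigenvectorUnitary A.isHermitian)
  · rintro _ ⟨U, rfl⟩
    exact hN.le_of_mem_permutohedron hperm (conjDiag_mem_permutohedron A.isHermitian U.2)

theorem IsNorm.comp_eig (hN : IsNorm ℝ N) (hperm : IsPermInvariant N) :
    IsNorm ℝ fun A : Herm n => N (eig A) where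
  nonneg A := hN.nonneg _
  eq_zero_iff A := by
    rw [hperm.apply_eig, hN.eq_zero_iff, Matrix.IsHermitian.eigenvalues_eq_zero_iff]
    exact ZeroMemClass.coe_eq_zero
  smul c A := by
    refine (hN.isGreatest_apply_eig hperm (c • A)).unique ?_
    obtain ⟨⟨U, hU⟩, hle⟩ := hN.isGreatest_apply_eig hperm A
    simp only [selfAdjoint.val_smul, map_smul, hN.smul]
    refine ⟨⟨U, congrArg (‖c‖ * ·) hU⟩, ?_⟩
    rintro _ ⟨V, rfl⟩
    exact mul_le_mul_of_nonneg_left (hle ⟨V, rfl⟩) (norm_nonneg c)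
  add_le A B := by
    obtain ⟨U, hU⟩ := (hN.isGreatest_apply_eig hperm (A + B)).1
    rw [← hU]
    dsimp only
    rw [AddSubgroup.coe_add, map_add]
    exact (hN.add_le _ _).trans (add_le_add ((hN.isGreatest_apply_eig hperm A).2 ⟨U, rfl⟩)
      ((hN.isGreatest_apply_eig hperm B).2 ⟨U, rfl⟩))

end Spectral

section Independence

variable {Ω ι : Type*} [MeasurableSpace Ω] {P : Measure Ω}

theorem exists_ae_eq_const_of_indepFun_self [IsProbabilityMeasure P] {Y : Ω → ℝ}
    (hY : AEMeasurable Y P) (h : IndepFun Y Y P) : ∃ c : ℝ, Y =ᵐ[P] fun _ => c := by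
  -- `arctan ∘ Y` is bounded, so it has a variance even if `Y` does not.
  set V : Ω → ℝ := Real.arctan ∘ Y with hV
  have hVm : AEMeasurable V P := Real.measurable_arctan.comp_aemeasurable hY
  have hV2 : MemLp V 2 P := memLp_of_bounded
    (.of_forall fun ω => Set.Ioo_subset_Icc_self (Real.arctan_mem_Ioo (Y ω)))
    hVm.aestronglyMeasurable 2
  have hvar : variance V P = 0 := by
    rw [← covariance_self hVm]
    exact (h.comp Real.measurable_arctan Real.measurable_arctan).covariance_eq_zero hV2 hV2
  refine ⟨Real.tan (∫ ω, V ω ∂P), ?_⟩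
  filter_upwards [ae_eq_integral_of_variance_eq_zero hV2 hvar] with ω hω
  rw [← hω, hV, Function.comp_apply, Real.tan_arctan]

theorem eq_zero_of_sum_mul_ae_eq_zero [Fintype ι] [IsProbabilityMeasure P] {X : ι → Ω → ℝ}
    (hX : ∀ i, AEMeasurable (X i) P) (hindep : iIndepFun X P)
    (hnondeg : ∀ i, ∀ c : ℝ, ¬ (X i =ᵐ[P] fun _ => c)) {x : ι → ℝ}
    (h : (fun ω => ∑ i, X i ω * x i) =ᵐ[P] 0) : x = 0 := by
  classical
  by_contra! hx
  obtain ⟨i, hi⟩ := Function.ne_iff.1 hx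
  let Y : ι → Ω → ℝ := fun j ω => X j ω * x j
  have hY : ∀ j, AEMeasurable (Y j) P := fun j => (hX j).mul_const (x j)
  have hYindep : iIndepFun Y P := hindep.comp (fun j t => t * x j) fun j => measurable_mul_const _
  have hrest : ∑ j ∈ Finset.univ.erase i, Y j =ᵐ[P] -Y i := by
    filter_upwards [h] with ω hω
    rw [Finset.sum_apply, Pi.neg_apply, eq_neg_iff_add_eq_zero,
      Finset.sum_erase_add _ _ (Finset.mem_univ i)]
    exact hω
  have hself : IndepFun (Y i) (Y i) P := by
    have h' := (hYindep.indepFun_finsetSum_of_notMem₀ hY (Finset.notMem_erase i _)).symm.congr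
      .rfl hrest
    simpa [Function.comp_def] using h'.comp measurable_id measurable_neg
  obtain ⟨c, hc⟩ := exists_ae_eq_const_of_indepFun_self (hY i) hself
  refine hnondeg i (c / x i) ?_
  filter_upwards [hc] with ω hω
  rw [eq_div_iff hi, ← hω]

end Independence

section VectorNorm

variable {Ω : Type*} [MeasurableSpace Ω] {P : Measure Ω} {n : ℕ} {X : Fin n → Ω → ℝ} {d : ℝ}

theorem memLp_pairing {p : ENNReal} (hX : ∀ i, MemLp (X i) p P) (x : Fin n → ℝ) :
    MemLp (pairing X x) p P :=
  memLp_finsetSum _ fun i _ => (hX i).mul_const (x i)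

theorem integrable_abs_pairing_rpow (hd : 0 < d) (hX : ∀ i, MemLp (X i) (ENNReal.ofReal d) P)
    (x : Fin n → ℝ) : Integrable (fun ω => |pairing X x ω| ^ d) P := by
  simpa [ENNReal.toReal_ofReal hd.le] using
    (memLp_pairing hX x).integrable_norm_rpow (by simpa using hd) ENNReal.ofReal_ne_top

/-- The random variable `⟨X, x⟩` as an element of `L^p`, linear in `x`: it makes `vecNorm` a
pull-back of the norm of `L^d`. -/
noncomputable def pairingLp {p : ENNReal} (hX : ∀ i, MemLp (X i) p P) :
    (Fin n → ℝ) →ₗ[ℝ] Lp ℝ p P where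
  toFun x := (memLp_pairing hX x).toLp
  map_add' x y := by
    rw [← MemLp.toLp_add, MemLp.toLp_eq_toLp_iff]
    exact .of_forall fun ω => by simp [pairing, mul_add, Finset.sum_add_distrib]
  map_smul' c x := by
    rw [RingHom.id_apply, ← MemLp.toLp_const_smul, MemLp.toLp_eq_toLp_iff]
    exact .of_forall fun ω => by simp [pairing, Finset.mul_sum, mul_left_comm]

theorem pairingLp_injective [IsProbabilityMeasure P] {p : ENNReal} (hX : ∀ i, MemLp (X i) p P)
    (hnondeg : ∀ i, ∀ c : ℝ, ¬ (X i =ᵐ[P] fun _ => c)) (hindep : iIndepFun X P) :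
    Function.Injective (pairingLp hX) := by
  refine (injective_iff_map_eq_zero _).2 fun x hx => ?_
  exact eq_zero_of_sum_mul_ae_eq_zero (fun i => (hX i).aestronglyMeasurable.aemeasurable) hindep
    hnondeg ((memLp_pairing hX x).toLp_eq_toLp_iff MemLp.zero |>.1 hx)

theorem vecNorm_eq_norm_pairingLp (hd : 0 < d) (hX : ∀ i, MemLp (X i) (ENNReal.ofReal d) P)
    (x : Fin n → ℝ) :
    vecNorm P X d x = ‖pairingLp hX x‖ / Real.Gamma (d + 1) ^ (1 / d) := by
  have hint : 0 ≤ ∫ ω, |pairing X x ω| ^ d ∂P := integral_nonneg fun ω => by positivity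
  have hnorm : ‖pairingLp hX x‖ = (eLpNorm (pairing X x) (ENNReal.ofReal d) P).toReal :=
    Lp.norm_toLp _ (memLp_pairing hX x)
  rw [hnorm, (memLp_pairing hX x).eLpNorm_eq_integral_rpow_norm (by simpa using hd)
    ENNReal.ofReal_ne_top, ENNReal.toReal_ofReal (by positivity), vecNorm,
    Real.div_rpow hint (Real.Gamma_pos_of_pos (by positivity)).le]
  simp [ENNReal.toReal_ofReal hd.le]

theorem isNorm_vecNorm [IsProbabilityMeasure P] (hd : 1 ≤ d)
    (hX : ∀ i, MemLp (X i) (ENNReal.ofReal d) P)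
    (hnondeg : ∀ i, ∀ c : ℝ, ¬ (X i =ᵐ[P] fun _ => c)) (hindep : iIndepFun X P) :
    IsNorm ℝ (vecNorm P X d) := by
  have hd0 : 0 < d := zero_lt_one.trans_le hd
  have : Fact (1 ≤ ENNReal.ofReal d) := ⟨ENNReal.one_le_ofReal.2 hd⟩
  have hΓ : 0 < Real.Gamma (d + 1) ^ (1 / d) :=
    Real.rpow_pos_of_pos (Real.Gamma_pos_of_pos (by positivity)) _
  rw [funext (vecNorm_eq_norm_pairingLp hd0 hX)]
  exact (isNorm_norm.comp_injective (pairingLp_injective hX hnondeg hindep)).div_const hΓ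

theorem isPermInvariant_vecNorm (hindep : iIndepFun X P)
    (hident : ∀ i j, IdentDistrib (X i) (X j) P P) (d : ℝ) :
    IsPermInvariant (vecNorm P X d) := by
  intro σ x
  have hdistrib : IdentDistrib (fun ω i => X i ω) (fun ω i => X (σ.symm i) ω) P P :=
    IdentDistrib.pi (fun i => hident i (σ.symm i)) hindep (hindep.precomp σ.symm.injective)
  have hmeas : Measurable fun v : Fin n → ℝ => |∑ i, v i * x i| ^ d := by fun_prop
  have hsum : ∀ ω, pairing X (x ∘ σ) ω = ∑ i, X (σ.symm i) ω * x i := fun ω =>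
    Fintype.sum_equiv σ _ _ fun i => by simp
  have hint : ∫ ω, |∑ i, X (σ.symm i) ω * x i| ^ d ∂P = ∫ ω, |pairing X x ω| ^ d ∂P :=
    (hdistrib.comp hmeas).symm.integral_eq
  simp only [vecNorm, hsum, hint]

end VectorNorm

section Bell

variable {R : Type*} [CommRing R]

/-- The coefficient of `t ^ r / r!` in the power series `F`, i.e. the `r`th term of the sequence of
which `F` is the exponential generating function. -/
noncomputable def egfCoeff (r : ℕ) (F : PowerSeries R) : R :=
  (r ! : R) * PowerSeries.coeff r F

theorem egfCoeff_add (r : ℕ) (F G : PowerSeries R) :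
    egfCoeff r (F + G) = egfCoeff r F + egfCoeff r G := by
  rw [egfCoeff, map_add, mul_add, egfCoeff, egfCoeff]

theorem egfCoeff_mul (r : ℕ) (F G : PowerSeries R) :
    egfCoeff r (F * G) =
      ∑ l ∈ Finset.range (r + 1), (r.choose l : R) * egfCoeff l F * egfCoeff (r - l) G := by
  rw [egfCoeff, PowerSeries.coeff_mul, Finset.Nat.sum_antidiagonal_eq_sum_range_succ_mk,
    Finset.mul_sum]
  refine Finset.sum_congr rfl fun l hl => ?_
  rw [← Nat.choose_mul_factorial_mul_factorial (Finset.mem_range_succ_iff.1 hl), egfCoeff, egfCoeff]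
  push_cast
  ring

theorem egfCoeff_derivative (r : ℕ) (F : PowerSeries R) :
    egfCoeff r (PowerSeries.derivative R F) = egfCoeff (r + 1) F := by
  rw [egfCoeff, egfCoeff, PowerSeries.coeff_derivative, Nat.factorial_succ]
  push_cast
  ring

variable [Algebra ℚ R]

/-- `∑_{j ≥ 1} x_j t^j / j!`, the logarithm of the exponential generating function of the complete
Bell polynomials in `x₁, x₂, …`. -/
noncomputable def bellLog (x : ℕ → R) : PowerSeries R :=
  PowerSeries.mk fun j => if j = 0 then 0 else algebraMap ℚ R (1 / (j ! : ℚ)) * x j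

/-- The exponential generating function of the complete Bell polynomials in `x₁, x₂, …`. -/
noncomputable def bellSeries (x : ℕ → R) : PowerSeries R := (PowerSeries.exp R).subst (bellLog x)

theorem egfCoeff_bellSeries (r : ℕ) (x : ℕ → R) : egfCoeff r (bellSeries x) = bell r x := rfl

theorem egfCoeff_bellLog_succ (r : ℕ) (x : ℕ → R) : egfCoeff (r + 1) (bellLog x) = x (r + 1) := by
  have hfact : ((r + 1)! : ℚ) ≠ 0 := Nat.cast_ne_zero.2 (Nat.factorial_ne_zero _)
  rw [egfCoeff, bellLog, PowerSeries.coeff_mk, if_neg r.succ_ne_zero, ← mul_assoc,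
    ← map_natCast (algebraMap ℚ R), ← map_mul, mul_one_div_cancel hfact, map_one, one_mul]

theorem constantCoeff_bellLog (x : ℕ → R) : PowerSeries.constantCoeff (bellLog x) = 0 := by
  rw [← PowerSeries.coeff_zero_eq_constantCoeff_apply, bellLog, PowerSeries.coeff_mk, if_pos rfl]

theorem derivative_bellSeries (x : ℕ → R) :
    PowerSeries.derivative R (bellSeries x) =
      bellSeries x * PowerSeries.derivative R (bellLog x) := by
  rw [bellSeries, PowerSeries.derivative_subst
    (PowerSeries.HasSubst.of_constantCoeff_zero' (constantCoeff_bellLog x)),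
    PowerSeries.derivative_exp]

theorem bell_zero (x : ℕ → R) : bell 0 x = 1 := by
  have hs := PowerSeries.HasSubst.of_constantCoeff_zero' (constantCoeff_bellLog x)
  have h : PowerSeries.constantCoeff ((PowerSeries.exp R - 1).subst (bellLog x)) = 0 :=
    PowerSeries.constantCoeff_subst_eq_zero (constantCoeff_bellLog x) _ (by simp)
  rw [← egfCoeff_bellSeries, bellSeries, ← sub_add_cancel (PowerSeries.exp R) 1,
    PowerSeries.subst_add hs, egfCoeff_add, ← PowerSeries.coe_substAlgHom hs, map_one,
    PowerSeries.coe_substAlgHom hs]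
  simp [egfCoeff, h]

theorem bell_succ (r : ℕ) (x : ℕ → R) :
    bell (r + 1) x =
      ∑ l ∈ Finset.range (r + 1), (r.choose l : R) * bell l x * x (r - l + 1) := by
  rw [← egfCoeff_bellSeries, ← egfCoeff_derivative, derivative_bellSeries, egfCoeff_mul]
  simp only [egfCoeff_derivative, egfCoeff_bellLog_succ, egfCoeff_bellSeries]

theorem eq_bell_of_recurrence {a x : ℕ → R} (h0 : a 0 = 1)
    (hsucc : ∀ r, a (r + 1) =
      ∑ l ∈ Finset.range (r + 1), (r.choose l : R) * a l * x (r - l + 1)) (r : ℕ) :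
    a r = bell r x := by
  induction r using Nat.strong_induction_on with
  | _ r ih =>
    cases r with
    | zero => rw [h0, bell_zero]
    | succ r =>
      rw [hsucc, bell_succ]
      exact Finset.sum_congr rfl fun l hl => by rw [ih l (Finset.mem_range.1 hl)]

theorem bell_add (r : ℕ) (x y : ℕ → R) :
    bell r (x + y) =
      ∑ l ∈ Finset.range (r + 1), (r.choose l : R) * bell l x * bell (r - l) y := by
  refine ((eq_bell_of_recurrence (a := fun s => egfCoeff s (bellSeries x * bellSeries y))
    ?_ fun s => ?_) r).symm.trans (egfCoeff_mul r _ _)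
  · simp [egfCoeff_mul, egfCoeff_bellSeries, bell_zero]
  · rw [← egfCoeff_derivative, Derivation.leibniz, derivative_bellSeries, derivative_bellSeries,
      smul_eq_mul, smul_eq_mul,
      show bellSeries x * (bellSeries y * PowerSeries.derivative R (bellLog y)) +
          bellSeries y * (bellSeries x * PowerSeries.derivative R (bellLog x)) =
        bellSeries x * bellSeries y *
          (PowerSeries.derivative R (bellLog x) + PowerSeries.derivative R (bellLog y)) by ring,
      egfCoeff_mul]
    simp only [egfCoeff_add, egfCoeff_derivative, egfCoeff_bellLog_succ, Pi.add_apply]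

theorem map_bell {S : Type*} [CommRing S] [Algebra ℚ S] (f : R →+* S) (r : ℕ) (x : ℕ → R) :
    f (bell r x) = bell r fun j => f (x j) := by
  refine eq_bell_of_recurrence (a := fun s => f (bell s x)) (by rw [bell_zero, map_one])
    (fun s => ?_) r
  simp only [bell_succ, map_sum, map_mul, map_natCast]

end Bell

section Partitions

/-- `∏_i (i!)^{m_i} m_i!`, where `m_i` is the multiplicity of `i` in `s`: the extension of `yPart`
to all multisets, which allows for induction on `s`. -/
def yMultiset (s : Multiset ℕ) : ℕ := ∏ i ∈ s.toFinset, i ! ^ s.count i * (s.count i)!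

theorem yMultiset_eq_prod_of_subset {s : Multiset ℕ} {T : Finset ℕ} (h : s.toFinset ⊆ T) :
    yMultiset s = ∏ i ∈ T, i ! ^ s.count i * (s.count i)! := by
  refine Finset.prod_subset h fun i _ hi => ?_
  rw [Multiset.mem_toFinset, ← Multiset.count_eq_zero] at hi
  simp [hi]

theorem yMultiset_cons (i : ℕ) (s : Multiset ℕ) :
    yMultiset (i ::ₘ s) = i ! * (s.count i + 1) * yMultiset s := by
  have hi : i ∈ insert i s.toFinset := Finset.mem_insert_self _ _
  have hrest : ∀ j ∈ (insert i s.toFinset).erase i, (i ::ₘ s).count j = s.count j := fun j hj =>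
    Multiset.count_cons_of_ne (Finset.ne_of_mem_erase hj) s
  rw [yMultiset_eq_prod_of_subset (T := insert i s.toFinset) (s := i ::ₘ s) (by simp),
    yMultiset_eq_prod_of_subset (Finset.subset_insert i _), ← Finset.mul_prod_erase _ _ hi,
    ← Finset.mul_prod_erase _ _ hi, Multiset.count_cons_self,
    Finset.prod_congr rfl fun j hj => by rw [hrest j hj], Nat.factorial_succ, pow_succ]
  ring

theorem yMultiset_pos (s : Multiset ℕ) : 0 < yMultiset s :=
  Finset.prod_pos fun _ _ => by positivity

/-- The partition obtained from `π` by adjoining the part `i`. -/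
def consPartition {m : ℕ} (i : ℕ) (hi : 0 < i) (π : Nat.Partition m) : Nat.Partition (i + m) where
  parts := i ::ₘ π.parts
  parts_pos h := by
    rcases Multiset.mem_cons.1 h with rfl | h
    exacts [hi, π.parts_pos h]
  parts_sum := by rw [Multiset.sum_cons, π.parts_sum]

theorem consPartition_injective {m i : ℕ} (hi : 0 < i) :
    Function.Injective (consPartition (m := m) i hi) := fun _ _ h =>
  Nat.Partition.ext ((Multiset.cons_inj_right i).1 (congrArg Nat.Partition.parts h))

theorem mem_range_consPartition {m i : ℕ} (hi : 0 < i) {π : Nat.Partition (i + m)}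
    (h : i ∈ π.parts) : π ∈ Set.range (consPartition (m := m) i hi) := by
  have hsum := π.parts_sum
  rw [← Multiset.cons_erase h, Multiset.sum_cons] at hsum
  exact ⟨⟨π.parts.erase i, fun hj => π.parts_pos (Multiset.mem_of_mem_erase hj),
    Nat.add_left_cancel hsum⟩, Nat.Partition.ext (Multiset.cons_erase h)⟩

theorem sum_succ_mul_count_succ {r : ℕ} (π : Nat.Partition (r + 1)) :
    ∑ k ∈ Finset.range (r + 1), (k + 1) * π.parts.count (k + 1) = r + 1 := by
  have hsub : π.parts.toFinset ⊆ Finset.range (r + 2) := fun i hi =>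
    Finset.mem_range_succ_iff.2 (Nat.Partition.le_of_mem_parts (Multiset.mem_toFinset.1 hi))
  have h := Finset.sum_multiset_count_of_subset π.parts _ hsub
  rw [π.parts_sum, Finset.sum_range_succ'] at h
  simpa [mul_comm] using h.symm

variable {R : Type*} [CommRing R] [Algebra ℚ R]

/-- The weight `x_π / y_π` of a multiset `π`, where `x_π = ∏_{i ∈ π} x_i`. -/
noncomputable def partWeight (x : ℕ → R) (s : Multiset ℕ) : R :=
  (yMultiset s : ℚ)⁻¹ • (s.map x).prod

theorem count_smul_partWeight_cons (x : ℕ → R) (i : ℕ) (s : Multiset ℕ) :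
    ((i ::ₘ s).count i : ℚ) • partWeight x (i ::ₘ s) = (i ! : ℚ)⁻¹ • (x i * partWeight x s) := by
  have hi : (i ! : ℚ) ≠ 0 := Nat.cast_ne_zero.2 i.factorial_ne_zero
  have hy : (yMultiset s : ℚ) ≠ 0 := Nat.cast_ne_zero.2 (yMultiset_pos s).ne'
  have hc : (s.count i + 1 : ℚ) ≠ 0 := Nat.cast_add_one_ne_zero _
  rw [partWeight, partWeight, mul_smul_comm, smul_smul, smul_smul, Multiset.map_cons,
    Multiset.prod_cons, yMultiset_cons, Multiset.count_cons_self]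
  congr 1
  push_cast
  field_simp

theorem sum_count_smul_partWeight (x : ℕ → R) {i m N : ℕ} (hi : 0 < i) (hN : i + m = N) :
    ∑ π : Nat.Partition N, (π.parts.count i : ℚ) • partWeight x π.parts =
      (i ! : ℚ)⁻¹ • (x i * ∑ π : Nat.Partition m, partWeight x π.parts) := by
  subst hN
  rw [Finset.mul_sum, Finset.smul_sum]
  symm
  refine Finset.sum_of_injOn (consPartition i hi) (consPartition_injective hi).injOn
    (fun _ _ => Finset.mem_univ _) (fun π _ hπ => ?_)
    fun π _ => (count_smul_partWeight_cons x i π.parts).symm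
  have hmem : i ∉ π.parts := fun h => hπ (by simpa using mem_range_consPartition hi h)
  rw [Multiset.count_eq_zero_of_notMem hmem, Nat.cast_zero, zero_smul]

theorem succ_smul_sum_partWeight (x : ℕ → R) (r : ℕ) :
    (r + 1 : ℚ) • ∑ π : Nat.Partition (r + 1), partWeight x π.parts =
      ∑ k ∈ Finset.range (r + 1),
        (k ! : ℚ)⁻¹ • (x (k + 1) * ∑ π : Nat.Partition (r - k), partWeight x π.parts) := by
  have hcount : ∀ π : Nat.Partition (r + 1), (r + 1 : ℚ) • partWeight x π.parts =
      ∑ k ∈ Finset.range (r + 1),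
        (k + 1 : ℚ) • ((π.parts.count (k + 1) : ℚ) • partWeight x π.parts) := fun π => by
    simp only [smul_smul, ← Finset.sum_smul]
    exact_mod_cast congrArg (fun t : ℕ => (t : ℚ) • partWeight x π.parts)
      (sum_succ_mul_count_succ π).symm
  simp_rw [Finset.smul_sum, hcount]
  rw [Finset.sum_comm]
  refine Finset.sum_congr rfl fun k hk => ?_
  have hk' : k + 1 + (r - k) = r + 1 := by have := Finset.mem_range.1 hk; omega
  have hk0 : (k + 1 : ℚ) ≠ 0 := Nat.cast_add_one_ne_zero k
  rw [← Finset.smul_sum, sum_count_smul_partWeight x k.succ_pos hk', smul_smul,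
    Nat.factorial_succ]
  congr 1
  push_cast
  field_simp

theorem bell_eq_sum_partWeight (m : ℕ) (x : ℕ → R) :
    bell m x = (m ! : ℚ) • ∑ π : Nat.Partition m, partWeight x π.parts := by
  symm
  refine eq_bell_of_recurrence
    (a := fun s => (s ! : ℚ) • ∑ π : Nat.Partition s, partWeight x π.parts)
    (by simp [partWeight, yMultiset]) (fun r => ?_) m
  rw [Nat.factorial_succ, Nat.cast_mul, mul_comm, mul_smul, Nat.cast_succ,
    succ_smul_sum_partWeight, ← Finset.sum_range_reflect, Finset.smul_sum]
  refine Finset.sum_congr rfl fun l hl => ?_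
  have hl' : l ≤ r := Finset.mem_range_succ_iff.1 hl
  have hchoose : (r.choose l : ℚ) * l ! * (r - l)! = r ! := by
    exact_mod_cast Nat.choose_mul_factorial_mul_factorial hl'
  have hfact : ((r - l)! : ℚ) ≠ 0 := Nat.cast_ne_zero.2 (Nat.factorial_ne_zero _)
  rw [Nat.add_sub_cancel, Nat.sub_sub_self hl', ← map_natCast (algebraMap ℚ R),
    ← Algebra.smul_def, smul_smul, smul_smul, smul_mul_assoc, mul_comm (x _), ← hchoose,
    mul_inv_cancel_right₀ hfact]

end Partitions

section Moments

variable {Ω ι : Type*} [MeasurableSpace Ω] {P : Measure Ω}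

theorem cumulant_eq_pow_mul_of_moment_eq {Y Z : Ω → ℝ} {a : ℝ}
    (h : ∀ j, moment Y j P = a ^ j * moment Z j P) (r : ℕ) :
    cumulant P Y r = a ^ r * cumulant P Z r := by
  induction r using Nat.strong_induction_on with
  | _ r ih =>
    cases r with
    | zero => simp [cumulant]
    | succ r =>
      rw [cumulant, cumulant, h, mul_sub, Finset.mul_sum]
      congr 1
      refine Finset.sum_congr rfl fun j _ => ?_
      rw [h, ih (r - j) (by omega), show r + 1 = j + 1 + (r - j) by omega, pow_add]
      ring

theorem cumulant_mul_const (Y : Ω → ℝ) (a : ℝ) (r : ℕ) :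
    cumulant P (fun ω => Y ω * a) r = a ^ r * cumulant P Y r := by
  refine cumulant_eq_pow_mul_of_moment_eq (fun j => ?_) r
  simp only [moment, Pi.pow_apply, mul_pow, integral_mul_const, mul_comm (a ^ j)]

theorem cumulant_zero (r : ℕ) : cumulant P (0 : Ω → ℝ) r = 0 := by
  cases r with
  | zero => simp only [cumulant]
  | succ r => simpa [Pi.zero_def] using cumulant_mul_const (P := P) (0 : Ω → ℝ) 0 (r + 1)

theorem cumulant_eq_of_identDistrib {Y Z : Ω → ℝ} (h : IdentDistrib Y Z P P) :
    cumulant P Y = cumulant P Z := by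
  have hmom : ∀ j, moment Y j P = 1 ^ j * moment Z j P := fun j => by
    rw [one_pow, one_mul]
    exact h.pow.integral_eq
  ext r
  rw [cumulant_eq_pow_mul_of_moment_eq hmom, one_pow, one_mul]

variable [IsProbabilityMeasure P]

theorem moment_zero_eq_one (Y : Ω → ℝ) : moment Y 0 P = 1 := by simp [moment]

theorem integrable_pow_of_memLp {Y : Ω → ℝ} {m k : ℕ} (hY : MemLp Y m P) (hk : k ≤ m) :
    Integrable (Y ^ k) P := by
  have h := (hY.mono_exponent (p := (k : ENNReal)) (by exact_mod_cast hk)).integrable_norm_pow'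
  exact h.mono' (hY.aestronglyMeasurable.pow k) (.of_forall fun ω => by simp)

theorem moment_add_of_indepFun {Y Z : Ω → ℝ} {m : ℕ} (hY : MemLp Y m P) (hZ : MemLp Z m P)
    (h : IndepFun Y Z P) :
    moment (Y + Z) m P =
      ∑ l ∈ Finset.range (m + 1), (m.choose l : ℝ) * moment Y l P * moment Z (m - l) P := by
  have hpow : ∀ l, IndepFun (Y ^ l) (Z ^ (m - l)) P := fun l =>
    h.comp (measurable_id.pow_const l) (measurable_id.pow_const (m - l))
  have hintY : ∀ l ∈ Finset.range (m + 1), Integrable (Y ^ l) P := fun l hl =>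
    integrable_pow_of_memLp hY (Finset.mem_range_succ_iff.1 hl)
  have hintZ : ∀ l, Integrable (Z ^ (m - l)) P := fun l =>
    integrable_pow_of_memLp hZ (Nat.sub_le m l)
  have hexpand : (Y + Z) ^ m = fun ω => ∑ l ∈ Finset.range (m + 1),
      (m.choose l : ℝ) * (Y ^ l * Z ^ (m - l)) ω := funext fun ω => by
    simp [add_pow, mul_comm]
  rw [moment, hexpand, integral_finsetSum _ fun l hl =>
    ((hpow l).integrable_mul (hintY l hl) (hintZ l)).const_mul _]
  refine Finset.sum_congr rfl fun l hl => ?_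
  rw [integral_const_mul, (hpow l).integral_mul_eq_mul_integral
    (hintY l hl).aestronglyMeasurable (hintZ l).aestronglyMeasurable, mul_assoc, moment, moment]

theorem moment_eq_bell_cumulant (Y : Ω → ℝ) (r : ℕ) : moment Y r P = bell r (cumulant P Y) := by
  refine eq_bell_of_recurrence (a := fun s => moment Y s P) (moment_zero_eq_one Y) (fun s => ?_) r
  rw [moment_eq_sum_cumulant P Y (s + 1) s.succ_pos]
  refine Finset.sum_congr rfl fun l hl => ?_
  rw [Nat.add_sub_cancel, Nat.sub_add_comm (Finset.mem_range_succ_iff.1 hl)]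

theorem moment_sum_eq_bell {Y : ι → Ω → ℝ} {m : ℕ} (hY : ∀ i, MemLp (Y i) m P)
    (hindep : iIndepFun Y P) (s : Finset ι) {j : ℕ} (hj : j ≤ m) :
    moment (∑ i ∈ s, Y i) j P = bell j (∑ i ∈ s, cumulant P (Y i)) := by
  classical
  induction s using Finset.induction_on generalizing j with
  | empty =>
    rw [Finset.sum_empty, Finset.sum_empty, moment_eq_bell_cumulant]
    exact congrArg _ (funext cumulant_zero)
  | insert i s hi ih =>
    have hadd := moment_add_of_indepFun
      ((hY i).mono_exponent (p := (j : ENNReal)) (by exact_mod_cast hj))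
      ((memLp_finsetSum' s fun k _ => hY k).mono_exponent (p := (j : ENNReal))
        (by exact_mod_cast hj))
      (hindep.indepFun_finsetSum_of_notMem₀
        (fun k => (hY k).aestronglyMeasurable.aemeasurable) hi).symm
    rw [Finset.sum_insert hi, Finset.sum_insert hi, hadd, bell_add]
    refine Finset.sum_congr rfl fun l _ => ?_
    rw [moment_eq_bell_cumulant (Y i), ih ((Nat.sub_le j l).trans hj)]

end Moments

section Pairing

variable {Ω : Type*} [MeasurableSpace Ω] {P : Measure Ω} {n : ℕ} {X : Fin n → Ω → ℝ} {Y : Ω → ℝ}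

theorem pairing_eq_sum {Ω : Type*} (X : Fin n → Ω → ℝ) (x : Fin n → ℝ) :
    pairing X x = ∑ i, fun ω => X i ω * x i := by
  ext ω
  simp [pairing]

theorem iIndepFun_mul_const (hindep : iIndepFun X P) (x : Fin n → ℝ) :
    iIndepFun (fun i ω => X i ω * x i) P :=
  hindep.comp (fun i s => s * x i) fun i => measurable_mul_const (x i)

theorem moment_pairing_eq_bell [IsProbabilityMeasure P] {m : ℕ} (hX : ∀ i, MemLp (X i) m P)
    (hindep : iIndepFun X P) (hident : ∀ i, IdentDistrib (X i) Y P P) (x : Fin n → ℝ) :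
    moment (pairing X x) m P = bell m fun j => cumulant P Y j * ∑ i, x i ^ j := by
  rw [pairing_eq_sum, moment_sum_eq_bell (fun i => (hX i).mul_const (x i))
    (iIndepFun_mul_const hindep x) _ le_rfl]
  congr 1
  ext j
  simp only [Finset.sum_apply, cumulant_mul_const, cumulant_eq_of_identDistrib (hident _),
    Finset.mul_sum, mul_comm]

theorem vecNorm_pow_eq_moment {m : ℕ} (hm : Even m) (hm0 : m ≠ 0) (x : Fin n → ℝ) :
    vecNorm P X m x ^ m = moment (pairing X x) m P / m ! := by
  have h0 : 0 ≤ (∫ ω, |pairing X x ω| ^ (m : ℝ) ∂P) / Real.Gamma (m + 1) :=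
    div_nonneg (integral_nonneg fun ω => by positivity) (Real.Gamma_pos_of_pos (by positivity)).le
  rw [vecNorm, one_div, Real.rpow_inv_natCast_pow h0 hm0, Real.Gamma_nat_eq_factorial]
  simp_rw [Real.rpow_natCast, hm.pow_abs]
  rfl

theorem vecNorm_pow_eq_bell [IsProbabilityMeasure P] {m : ℕ} (hm : Even m) (hm0 : m ≠ 0)
    (hX : ∀ i, MemLp (X i) m P) (hindep : iIndepFun X P)
    (hident : ∀ i, IdentDistrib (X i) Y P P) (x : Fin n → ℝ) :
    vecNorm P X m x ^ m = (bell m fun j => cumulant P Y j * ∑ i, x i ^ j) / m ! := by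
  rw [vecNorm_pow_eq_moment hm hm0, moment_pairing_eq_bell hX hindep hident]

theorem bell_mul_psum_div_factorial (κ : ℕ → ℝ) (m : ℕ) (x : Fin n → ℝ) :
    (bell m fun j => κ j * ∑ i, x i ^ j) / m ! =
      ∑ π : Nat.Partition m, kappaPart κ π * psumPart π x / yPart π := by
  have hm : (m ! : ℝ) ≠ 0 := Nat.cast_ne_zero.2 m.factorial_ne_zero
  rw [bell_eq_sum_partWeight, Rat.smul_def, Rat.cast_natCast, mul_div_cancel_left₀ _ hm]
  refine Finset.sum_congr rfl fun π _ => ?_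
  rw [partWeight, Multiset.prod_map_mul, Rat.smul_def, Rat.cast_inv, Rat.cast_natCast, mul_comm]
  rfl

theorem vecNorm_pow_eq_sum_partition [IsProbabilityMeasure P] {m : ℕ} (hm : Even m) (hm0 : m ≠ 0)
    (hX : ∀ i, MemLp (X i) m P) (hindep : iIndepFun X P)
    (hident : ∀ i, IdentDistrib (X i) Y P P) (x : Fin n → ℝ) :
    vecNorm P X m x ^ m =
      ∑ π : Nat.Partition m, kappaPart (cumulant P Y) π * psumPart π x / yPart π := by
  rw [vecNorm_pow_eq_bell hm hm0 hX hindep hident, bell_mul_psum_div_factorial]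

theorem integrable_exp_mul_pairing [IsProbabilityMeasure P] (hX : ∀ i, AEMeasurable (X i) P)
    (hindep : iIndepFun X P) {x : Fin n → ℝ} {t : ℝ}
    (h : ∀ i, x i * t ∈ integrableExpSet (X i) P) : t ∈ integrableExpSet (pairing X x) P := by
  have hsum : ∀ s : Finset (Fin n),
      Integrable (fun ω => Real.exp (t * (∑ i ∈ s, fun ω => X i ω * x i) ω)) P := fun s => by
    induction s using Finset.induction_on with
    | empty => simp
    | insert i s hi ih =>
      rw [Finset.sum_insert hi]
      refine ((iIndepFun_mul_const hindep x).indepFun_finsetSum_of_notMem₀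
        (fun j => (hX j).mul_const (x j)) hi).symm.integrable_exp_mul_add ?_ ih
      simpa only [integrableExpSet, Set.mem_ofPred_eq, mul_left_comm, mul_comm, mul_assoc] using h i
  simpa only [integrableExpSet, Set.mem_ofPred_eq, pairing_eq_sum] using hsum Finset.univ

theorem zero_mem_interior_integrableExpSet_pairing [IsProbabilityMeasure P]
    (hindep : iIndepFun X P) (hident : ∀ i, IdentDistrib (X i) Y P P)
    (hY : 0 ∈ interior (integrableExpSet Y P)) (x : Fin n → ℝ) :
    0 ∈ interior (integrableExpSet (pairing X x) P) := by
  rw [mem_interior_iff_mem_nhds] at hY ⊢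
  have h : ∀ i, ∀ᶠ t in 𝓝 (0 : ℝ), x i * t ∈ integrableExpSet Y P := fun i => by
    have hc : Filter.Tendsto (fun t : ℝ => x i * t) (𝓝 0) (𝓝 0) := by
      simpa using (continuous_const_mul (x i)).tendsto 0
    exact hc hY
  filter_upwards [Filter.eventually_all.2 h] with t ht
  refine integrable_exp_mul_pairing (fun i => (hident i).aemeasurable_fst) hindep fun i => ?_
  have hu : Measurable fun s : ℝ => Real.exp (x i * t * s) := by fun_prop
  exact ((hident i).comp hu).integrable_iff.2 (ht i)

theorem mgf_pairing (hindep : iIndepFun X P) (hident : ∀ i, IdentDistrib (X i) Y P P)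
    (x : Fin n → ℝ) (t : ℝ) : mgf (pairing X x) P t = ∏ i, mgf Y P (x i * t) := by
  rw [pairing_eq_sum, (iIndepFun_mul_const hindep x).mgf_sum₀
    fun i => (hident i).aemeasurable_fst.mul_const (x i)]
  refine Finset.prod_congr rfl fun i _ => ?_
  rw [← mgf_congr_of_identDistrib (X i) Y (hident i)]
  simp only [mgf, mul_left_comm, mul_comm]

theorem hasPowerSeriesCoeff_mgf (hY : 0 ∈ interior (integrableExpSet Y P)) (m : ℕ) :
    HasPowerSeriesCoeff (mgf Y P) m (moment Y m P / m !) := by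
  refine ⟨fun j => moment Y j P / j !, ?_, rfl⟩
  filter_upwards [(hasFPowerSeriesAt_mgf hY).eventually_hasSum] with t ht
  simpa [FormalMultilinearSeries.ofScalars_apply_eq, mul_comm, moment] using ht

theorem hasPowerSeriesCoeff_prod_mgf [IsProbabilityMeasure P] {m : ℕ} (hm : Even m) (hm0 : m ≠ 0)
    (hindep : iIndepFun X P) (hident : ∀ i, IdentDistrib (X i) Y P P)
    (hY : 0 ∈ interior (integrableExpSet Y P)) (x : Fin n → ℝ) :
    HasPowerSeriesCoeff (fun t => ∏ i, mgf Y P (x i * t)) m (vecNorm P X m x ^ m) := by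
  rw [vecNorm_pow_eq_moment hm hm0, ← funext (mgf_pairing hindep hident x)]
  exact hasPowerSeriesCoeff_mgf
    (zero_mem_interior_integrableExpSet_pairing hindep hident hY x) m

end Pairing

section SymmetricPolynomial

/-- The symmetric polynomial `∑_{π ⊢ m} κ_π p_π / y_π`. -/
noncomputable def normPolynomial (n : ℕ) (κ : ℕ → ℝ) (m : ℕ) : MvPolynomial (Fin n) ℝ :=
  ∑ π : Nat.Partition m,
    MvPolynomial.C (kappaPart κ π / yPart π) * MvPolynomial.psumPart (Fin n) ℝ π

theorem eval_normPolynomial (n : ℕ) (κ : ℕ → ℝ) (m : ℕ) (x : Fin n → ℝ) :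
    MvPolynomial.eval x (normPolynomial n κ m) =
      ∑ π : Nat.Partition m, kappaPart κ π * psumPart π x / yPart π := by
  have hpsum : ∀ k, MvPolynomial.eval x (MvPolynomial.psum (Fin n) ℝ k) = ∑ i, x i ^ k :=
    fun k => by simp [MvPolynomial.psum]
  simp [normPolynomial, MvPolynomial.psumPart, psumPart, map_multiset_prod, Multiset.map_map,
    hpsum, div_mul_eq_mul_div]

theorem isSymmetric_normPolynomial (n : ℕ) (κ : ℕ → ℝ) (m : ℕ) :
    (normPolynomial n κ m).IsSymmetric := by
  rw [← MvPolynomial.mem_symmetricSubalgebra]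
  refine Subalgebra.sum_mem _ fun π _ => Subalgebra.mul_mem _ (Subalgebra.algebraMap_mem _ _) ?_
  refine Subalgebra.multiset_prod_mem _ fun p hp => ?_
  obtain ⟨k, -, rfl⟩ := Multiset.mem_map.1 hp
  exact (MvPolynomial.mem_symmetricSubalgebra _).2 (MvPolynomial.psum_isSymmetric _ _ k)

theorem isHomogeneous_multisetProd_psum {σ R : Type*} [Fintype σ] [CommSemiring R]
    (s : Multiset ℕ) : ((s.map (MvPolynomial.psum σ R)).prod).IsHomogeneous s.sum := by
  induction s using Multiset.induction_on with
  | empty => simpa using MvPolynomial.isHomogeneous_one σ R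
  | cons k s ih =>
    rw [Multiset.map_cons, Multiset.prod_cons, Multiset.sum_cons]
    exact (MvPolynomial.IsHomogeneous.sum _ _ _ fun i _ =>
      MvPolynomial.isHomogeneous_X_pow i k).mul ih

theorem isHomogeneous_normPolynomial (n : ℕ) (κ : ℕ → ℝ) (m : ℕ) :
    (normPolynomial n κ m).IsHomogeneous m := by
  refine MvPolynomial.IsHomogeneous.sum _ _ _ fun π _ => .C_mul ?_ _
  simpa only [MvPolynomial.psumPart, π.parts_sum] using
    isHomogeneous_multisetProd_psum (σ := Fin n) (R := ℝ) π.parts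

theorem IsNorm.exists_mvPolynomial {n m : ℕ} {N : (Fin n → ℝ) → ℝ}
    (hN : IsNorm ℝ N) {κ : ℕ → ℝ}
    (h : ∀ x, N x ^ m = ∑ π : Nat.Partition m, kappaPart κ π * psumPart π x / yPart π) :
    ∃ p : MvPolynomial (Fin n) ℝ, p.IsSymmetric ∧ p.IsHomogeneous m ∧
      IsPositiveDefinite (fun x => MvPolynomial.eval x p) ∧
      ∀ x, N x ^ m = MvPolynomial.eval x p := by
  simp_rw [← eval_normPolynomial] at h
  refine ⟨normPolynomial n κ m, isSymmetric_normPolynomial n κ m,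
    isHomogeneous_normPolynomial n κ m, ?_, h⟩
  simp_rw [← h]
  exact hN.isPositiveDefinite_pow (by simpa only [h] using MvPolynomial.continuous_eval _)

end SymmetricPolynomial

section TracePowers

variable {n : ℕ}

theorem sum_eig_pow (A : Herm n) (k : ℕ) :
    ((∑ i, eig A i ^ k : ℝ) : ℂ) = ((A : Matrix (Fin n) (Fin n) ℂ) ^ k).trace := by
  obtain ⟨σ, hσ⟩ := exists_eig_eq_eigenvalues_comp A
  have hperm : ∑ i, eig A i ^ k = ∑ i, A.isHermitian.eigenvalues i ^ k := by
    rw [hσ]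
    exact Equiv.sum_comp σ fun i => A.isHermitian.eigenvalues i ^ k
  rw [hperm]
  conv_rhs => rw [A.isHermitian.spectral_theorem, ← map_pow, Unitary.conjStarAlgAut_apply,
    Matrix.trace_mul_cycle, Unitary.coe_star_mul_self, one_mul, Matrix.diagonal_pow,
    Matrix.trace_diagonal]
  simp

theorem psumPart_eig {m : ℕ} (π : Nat.Partition m) (A : Herm n) :
    (psumPart π (eig A) : ℂ) =
      (π.parts.map fun k => ((A : Matrix (Fin n) (Fin n) ℂ) ^ k).trace).prod := by
  rw [psumPart, ← Complex.ofRealHom_eq_coe, map_multiset_prod, Multiset.map_map]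
  simp only [Function.comp_def, Complex.ofRealHom_eq_coe, sum_eig_pow]

theorem bell_mul_trace_pow (κ : ℕ → ℝ) (m : ℕ) (A : Herm n) :
    (bell m fun j => (κ j : ℂ) * ((A : Matrix (Fin n) (Fin n) ℂ) ^ j).trace) =
      ((bell m fun j => κ j * ∑ i, eig A i ^ j : ℝ) : ℂ) := by
  rw [← Complex.ofRealHom_eq_coe, map_bell]
  simp only [map_mul, Complex.ofRealHom_eq_coe, sum_eig_pow]

theorem hermNorm_pow_eq_bell_trace {Ω : Type*} [MeasurableSpace Ω] {P : Measure Ω}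
    [IsProbabilityMeasure P] {X : Fin n → Ω → ℝ} {Y : Ω → ℝ} {m : ℕ} (hm : Even m) (hm0 : m ≠ 0)
    (hX : ∀ i, MemLp (X i) m P) (hindep : iIndepFun X P)
    (hident : ∀ i, IdentDistrib (X i) Y P P) (A : Herm n) :
    ((hermNorm P X m A ^ m : ℝ) : ℂ) = 1 / (m ! : ℂ) *
      bell m fun j => (cumulant P Y j : ℂ) * ((A : Matrix (Fin n) (Fin n) ℂ) ^ j).trace := by
  rw [bell_mul_trace_pow, hermNorm, vecNorm_pow_eq_bell hm hm0 hX hindep hident, one_div,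
    div_eq_inv_mul]
  push_cast
  rfl

end TracePowers

section BlockTrace

variable {n R : Type*} [Fintype n] [DecidableEq n] [CommSemiring R]

/-- `(tr w₁)(tr w₂) ⋯`, where the word `w` is cut into consecutive blocks `w₁, w₂, …` of given
lengths. -/
def blockTrace (ls : List ℕ) (w : List (Matrix n n R)) : R :=
  ((ls.splitLengths w).map fun u => u.prod.trace).prod

theorem blockTrace_cons (l : ℕ) (ls : List ℕ) (w : List (Matrix n n R)) :
    blockTrace (l :: ls) w = (w.take l).prod.trace * blockTrace ls (w.drop l) := by
  simp [blockTrace, List.splitLengths_cons]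

theorem blockTrace_replicate (ls : List ℕ) (B : Matrix n n R) :
    blockTrace ls (List.replicate ls.sum B) = (ls.map fun l => (B ^ l).trace).prod := by
  induction ls with
  | nil => simp [blockTrace]
  | cons l ls ih =>
    rw [blockTrace_cons, List.sum_cons, List.take_replicate, List.drop_replicate,
      Nat.add_sub_cancel_left, ih, Nat.min_eq_left (Nat.le_add_right _ _), List.prod_replicate,
      List.map_cons, List.prod_cons]

theorem exists_linearMap_blockTrace (ls : List ℕ) (w₁ w₂ : List (Matrix n n R))
    (h : w₁.length < ls.sum) :
    ∃ L : Matrix n n R →ₗ[R] R, ∀ Z, blockTrace ls (w₁ ++ Z :: w₂) = L Z := by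
  induction ls generalizing w₁ with
  | nil => simp at h
  | cons l ls ih =>
    rcases lt_or_ge w₁.length l with hl | hl
    · obtain ⟨k, rfl⟩ : ∃ k, l = w₁.length + (k + 1) := ⟨l - w₁.length - 1, by omega⟩
      refine ⟨blockTrace ls (w₂.drop k) • (Matrix.traceLinearMap n R R ∘ₗ
        LinearMap.mulLeft R w₁.prod ∘ₗ LinearMap.mulRight R (w₂.take k).prod), fun Z => ?_⟩
      rw [blockTrace_cons, List.take_length_add_append, List.drop_length_add_append,
        List.take_succ_cons, List.drop_succ_cons, List.prod_append, List.prod_cons]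
      simp [mul_comm]
    · have hdrop : (w₁.drop l).length < ls.sum := by
        simp only [List.sum_cons, List.length_drop] at h ⊢
        omega
      obtain ⟨L, hL⟩ := ih (w₁.drop l) hdrop
      refine ⟨(w₁.take l).prod.trace • L, fun Z => ?_⟩
      rw [blockTrace_cons, List.take_append_of_le_length hl, List.drop_append_of_le_length hl, hL]
      rfl

theorem ofFn_update_eq_append {α : Type*} {d : ℕ} (v : Fin d → α) (i : Fin d) (z : α) :
    List.ofFn (Function.update v i z) =
      (List.ofFn v).take i ++ z :: (List.ofFn v).drop (i + 1) := by
  have h : List.ofFn (Function.update v i z) = (List.ofFn v).set i z :=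
    List.ext_getElem (by simp) fun k _ _ => by
      simp [List.getElem_set, Function.update_apply, Fin.ext_iff, eq_comm]
  rw [h, List.set_eq_take_append_cons_drop, if_pos (by simp)]

theorem exists_linearMap_blockTrace_update {d : ℕ} {ls : List ℕ} (h : ls.sum = d)
    (v : Fin d → Matrix n n R) (i : Fin d) :
    ∃ L : Matrix n n R →ₗ[R] R, ∀ Z, blockTrace ls (List.ofFn (Function.update v i Z)) = L Z := by
  simp only [ofFn_update_eq_append]
  exact exists_linearMap_blockTrace ls _ _ (by simp [h])

/-- `blockTrace`, as a multilinear function of the letters of a word of length `d`. -/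
def blockTraceMultilinear {d : ℕ} (ls : List ℕ) (h : ls.sum = d) :
    MultilinearMap R (fun _ : Fin d => Matrix n n R) R :=
  MultilinearMap.mk' (fun v => blockTrace ls (List.ofFn v))
    (fun v i x y => by
      obtain ⟨L, hL⟩ := exists_linearMap_blockTrace_update h v i
      simp only [hL, map_add])
    (fun v i c x => by
      obtain ⟨L, hL⟩ := exists_linearMap_blockTrace_update h v i
      simp only [hL, map_smul])

end BlockTrace

section TracePart

theorem prod_ite_mem_const {ι M : Type*} [Fintype ι] [DecidableEq ι] [CommMonoid M] (S : Finset ι)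
    (a b : M) : ∏ i, (if i ∈ S then b else a) = b ^ S.card * a ^ (Fintype.card ι - S.card) := by
  simp [Finset.prod_ite, Finset.filter_not, ← Finset.compl_eq_univ_sdiff, Finset.card_compl]

theorem sum_sort_parts {d : ℕ} (π : Nat.Partition d) : (π.parts.sort (· ≥ ·)).sum = d := by
  rw [← Multiset.sum_coe, Multiset.sort_eq, π.parts_sum]

variable {n d : ℕ}

/-- `(tr w₁)(tr w₂) ⋯ (tr w_r)`, where `w₁ w₂ ⋯ w_r` is a word of length `d` that is cut into
consecutive blocks of lengths `π₁ ≥ ⋯ ≥ π_r`. -/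
noncomputable def partTrace (π : Nat.Partition d) :
    MultilinearMap ℂ (fun _ : Fin d => Matrix (Fin n) (Fin n) ℂ) ℂ :=
  blockTraceMultilinear (π.parts.sort (· ≥ ·)) (sum_sort_parts π)

theorem partTrace_const (π : Nat.Partition d) (B : Matrix (Fin n) (Fin n) ℂ) :
    partTrace π (fun _ => B) = (π.parts.map fun l => (B ^ l).trace).prod := by
  calc partTrace π (fun _ => B)
      = blockTrace (π.parts.sort (· ≥ ·)) (List.ofFn fun _ : Fin d => B) := rfl
    _ = blockTrace (π.parts.sort (· ≥ ·)) (List.replicate (π.parts.sort (· ≥ ·)).sum B) := by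
        rw [List.ofFn_const, sum_sort_parts]
    _ = ((π.parts.sort (· ≥ ·)).map fun l => (B ^ l).trace).prod := blockTrace_replicate _ _
    _ = (π.parts.map fun l => (B ^ l).trace).prod := by
        rw [← Multiset.prod_coe, ← Multiset.map_coe, Multiset.sort_eq]

/-- The word of length `d` in `Z` and `Zᴴ`, with `Zᴴ` in the places in `S`. -/
def adjointWord (Z : Matrix (Fin n) (Fin n) ℂ) (S : Finset (Fin d)) :
    Fin d → Matrix (Fin n) (Fin n) ℂ :=
  fun i => if i ∈ S then Zᴴ else Z

theorem partTrace_smul_adjointWord (π : Nat.Partition d) (a b : ℂ) (Z : Matrix (Fin n) (Fin n) ℂ)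
    (S : Finset (Fin d)) :
    partTrace π (fun i => (if i ∈ S then b else a) • adjointWord Z S i) =
      b ^ S.card * a ^ (d - S.card) * partTrace π (adjointWord Z S) := by
  rw [MultilinearMap.map_smul_univ, prod_ite_mem_const, Fintype.card_fin, smul_eq_mul]

theorem prod_trace_pow_eq_sum (π : Nat.Partition d) (Z : Matrix (Fin n) (Fin n) ℂ) (a b : ℂ) :
    (π.parts.map fun l => ((a • Z + b • Zᴴ) ^ l).trace).prod =
      ∑ S : Finset (Fin d), b ^ S.card * a ^ (d - S.card) * partTrace π (adjointWord Z S) := by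
  rw [← partTrace_const, add_comm (a • Z)]
  refine ((partTrace π).map_add_univ (fun _ => b • Zᴴ) fun _ => a • Z).trans
    (Finset.sum_congr rfl fun S _ => ?_)
  rw [← partTrace_smul_adjointWord]
  congr 1
  ext i : 1
  by_cases hi : i ∈ S <;> simp [adjointWord, hi]

theorem tracePart_eq (π : Nat.Partition d) (Z : Matrix (Fin n) (Fin n) ℂ) :
    tracePart π Z = (∑ S ∈ Finset.powersetCard (d / 2) (Finset.univ : Finset (Fin d)),
      partTrace π (adjointWord Z S)) / (d.choose (d / 2) : ℂ) :=
  rfl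

theorem choose_half_pos (d : ℕ) : 0 < d.choose (d / 2) :=
  Nat.choose_pos (Nat.div_le_self d 2)

theorem tracePart_smul (hd : Even d) (π : Nat.Partition d) (c : ℂ)
    (Z : Matrix (Fin n) (Fin n) ℂ) : tracePart π (c • Z) = (‖c‖ ^ d : ℝ) * tracePart π Z := by
  rw [tracePart_eq, tracePart_eq, ← mul_div_assoc, Finset.mul_sum]
  congr 1
  refine Finset.sum_congr rfl fun S hS => ?_
  obtain ⟨e, rfl⟩ := hd
  have hcard : S.card = e := by rw [(Finset.mem_powersetCard.1 hS).2]; omega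
  have hword : adjointWord (c • Z) S =
      fun i => (if i ∈ S then star c else c) • adjointWord Z S i := by
    ext i : 1
    by_cases hi : i ∈ S <;> simp [adjointWord, hi]
  rw [hword, partTrace_smul_adjointWord, hcard, Nat.add_sub_cancel, ← mul_pow, mul_comm (star c),
    Complex.star_def, Complex.mul_conj, Complex.normSq_eq_norm_sq, ← Complex.ofReal_pow,
    ← pow_mul, two_mul]

theorem tracePart_herm (π : Nat.Partition d) (A : Herm n) :
    tracePart π (A : Matrix (Fin n) (Fin n) ℂ) =
      (π.parts.map fun l => ((A : Matrix (Fin n) (Fin n) ℂ) ^ l).trace).prod := by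
  have hword : ∀ S : Finset (Fin d), adjointWord (A : Matrix (Fin n) (Fin n) ℂ) S = fun _ => A.1 :=
    fun S => funext fun i => by simp only [adjointWord, A.isHermitian.eq, ite_self]
  simp only [tracePart_eq, hword, partTrace_const]
  rw [Finset.sum_const, Finset.card_powersetCard, Finset.card_univ, Fintype.card_fin,
    nsmul_eq_mul, mul_div_cancel_left₀ _ (Nat.cast_ne_zero.2 (choose_half_pos d).ne')]

theorem tracePart_herm_eq_psumPart (π : Nat.Partition d) (A : Herm n) :
    tracePart π (A : Matrix (Fin n) (Fin n) ℂ) = psumPart π (eig A) :=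
  (tracePart_herm π A).trans (psumPart_eig π A).symm

end TracePart

section RootsOfUnity

theorem sum_zpow_pow_of_isPrimitiveRoot {K : Type*} [Field K] {ω : K} {N : ℕ}
    (hω : IsPrimitiveRoot ω N) (j : ℤ) :
    ∑ k : Fin N, (ω ^ j) ^ (k : ℕ) = if (N : ℤ) ∣ j then (N : K) else 0 := by
  rw [Fin.sum_univ_eq_sum_range fun k => (ω ^ j) ^ k]
  split_ifs with hj
  · simp [(hω.zpow_eq_one_iff_dvd j).2 hj]
  · have hpow : (ω ^ j) ^ N = 1 := by
      rw [← zpow_natCast, ← zpow_mul, mul_comm, zpow_mul, zpow_natCast, hω.pow_eq_one, one_zpow]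
    rw [geom_sum_eq (mt (hω.zpow_eq_one_iff_dvd j).1 hj), hpow, sub_self, zero_div]

variable {d : ℕ} {ω : ℂ}

theorem star_eq_inv_of_isPrimitiveRoot (hω : IsPrimitiveRoot ω (d + 1)) : star ω = ω⁻¹ :=
  (Complex.inv_eq_conj (hω.norm'_eq_one d.succ_ne_zero)).symm

theorem sum_star_pow_mul_pow (hω : IsPrimitiveRoot ω (d + 1)) {s : ℕ} (hs : s ≤ d) :
    ∑ k : Fin (d + 1), star (ω ^ (k : ℕ)) ^ s * (ω ^ (k : ℕ)) ^ (d - s) =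
      if 2 * s = d then (d + 1 : ℂ) else 0 := by
  have hω0 : ω ≠ 0 := hω.ne_zero d.succ_ne_zero
  have hterm : ∀ k : ℕ, star (ω ^ k) ^ s * (ω ^ k) ^ (d - s) = (ω ^ ((d : ℤ) - 2 * s)) ^ k := by
    intro k
    rw [star_pow, star_eq_inv_of_isPrimitiveRoot hω, pow_right_comm, pow_right_comm ω, ← mul_pow]
    congr 1
    rw [inv_pow, ← zpow_natCast, ← zpow_natCast, ← zpow_neg, ← zpow_add₀ hω0, Nat.cast_sub hs]
    congr 1
    ring
  have hdvd : ((d + 1 : ℕ) : ℤ) ∣ d - 2 * s ↔ 2 * s = d := by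
    refine ⟨fun h => ?_, fun h => ⟨0, by omega⟩⟩
    have := Int.eq_zero_of_abs_lt_dvd h (by rw [abs_lt]; omega)
    omega
  simp only [hterm, sum_zpow_pow_of_isPrimitiveRoot hω, hdvd]
  rw [Nat.cast_succ]

end RootsOfUnity

section Twist

variable {n d : ℕ} {ω : ℂ}

/-- The Hermitian matrix `u Z + ū Zᴴ`, as a real-linear function of `Z`. -/
def twist (u : ℂ) : Matrix (Fin n) (Fin n) ℂ →ₗ[ℝ] Herm n where
  toFun Z := ⟨u • Z + star u • Zᴴ, by
    rw [selfAdjoint.mem_iff, Matrix.star_eq_conjTranspose]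
    simp [add_comm]⟩
  map_add' Z W := by
    ext1
    simp only [AddSubgroup.coe_add, Matrix.conjTranspose_add, smul_add]
    abel
  map_smul' c Z := by
    ext1
    simp [smul_comm c]

theorem coe_twist (u : ℂ) (Z : Matrix (Fin n) (Fin n) ℂ) :
    (twist u Z : Matrix (Fin n) (Fin n) ℂ) = u • Z + star u • Zᴴ :=
  rfl

theorem eq_zero_of_twist_eq_zero {u : ℂ} (hu : star u ≠ u) {Z : Matrix (Fin n) (Fin n) ℂ}
    (h1 : twist 1 Z = 0) (h2 : twist u Z = 0) : Z = 0 := by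
  have hadj : Zᴴ = -Z := eq_neg_of_add_eq_zero_right <| by
    simpa [coe_twist] using congrArg Subtype.val h1
  have hsub : (u - star u) • Z = 0 := by
    have h2' : u • Z + star u • Zᴴ = 0 := congrArg Subtype.val h2
    rwa [hadj, smul_neg, ← sub_eq_add_neg, ← sub_smul] at h2'
  exact (smul_eq_zero.1 hsub).resolve_left (sub_ne_zero.2 hu.symm)

/-- The Hermitian matrices `ωᵏ Z + ω⁻ᵏ Zᴴ`, for `k = 0, …, d`. -/
noncomputable def twists (d : ℕ) (ω : ℂ) : Matrix (Fin n) (Fin n) ℂ →ₗ[ℝ] Fin (d + 1) → Herm n :=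
  LinearMap.pi fun k => twist (ω ^ (k : ℕ))

theorem twists_injective (hω : IsPrimitiveRoot ω (d + 1)) (hd : 2 ≤ d) :
    Function.Injective (twists d ω : Matrix (Fin n) (Fin n) ℂ →ₗ[ℝ] Fin (d + 1) → Herm n) := by
  have hne : star ω ≠ ω := fun h => by
    have hsq : ω ^ 2 = 1 := by
      nth_rw 1 [sq, ← h, star_eq_inv_of_isPrimitiveRoot hω,
        inv_mul_cancel₀ (hω.ne_zero d.succ_ne_zero)]
    exact hω.pow_ne_one_of_pos_of_lt two_ne_zero (by omega) hsq
  refine (injective_iff_map_eq_zero _).2 fun Z hZ => ?_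
  have hk : ∀ k : Fin (d + 1), twist (ω ^ (k : ℕ)) Z = 0 := congrFun hZ
  exact eq_zero_of_twist_eq_zero hne (by simpa using hk 0)
    (by simpa using hk ⟨1, by omega⟩)

theorem sum_tracePart_twists (hd : Even d) (hω : IsPrimitiveRoot ω (d + 1))
    (π : Nat.Partition d) (Z : Matrix (Fin n) (Fin n) ℂ) :
    ∑ k, tracePart π (twists d ω Z k : Matrix (Fin n) (Fin n) ℂ) =
      ((d + 1) * d.choose (d / 2) : ℝ) * tracePart π Z := by
  have hcoeff : ∀ S : Finset (Fin d),
      ∑ k : Fin (d + 1), star (ω ^ (k : ℕ)) ^ S.card * (ω ^ (k : ℕ)) ^ (d - S.card) =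
        if S.card = d / 2 then (d + 1 : ℂ) else 0 := fun S => by
    obtain ⟨e, rfl⟩ := hd
    rw [sum_star_pow_mul_pow hω ((Finset.card_le_univ S).trans_eq (Fintype.card_fin _))]
    congr 1
    rw [eq_iff_iff]
    omega
  calc ∑ k, tracePart π (twists d ω Z k : Matrix (Fin n) (Fin n) ℂ)
      = ∑ S : Finset (Fin d), (∑ k : Fin (d + 1), star (ω ^ (k : ℕ)) ^ S.card *
          (ω ^ (k : ℕ)) ^ (d - S.card)) * partTrace π (adjointWord Z S) := by
        simp only [Finset.sum_mul]
        rw [Finset.sum_comm]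
        refine Finset.sum_congr rfl fun k _ => ?_
        rw [tracePart_herm, ← prod_trace_pow_eq_sum]
        rfl
    _ = (d + 1) * ∑ S ∈ Finset.powersetCard (d / 2) (Finset.univ : Finset (Fin d)),
          partTrace π (adjointWord Z S) := by
        simp only [hcoeff, ite_mul, zero_mul]
        rw [← Finset.sum_filter, Finset.mul_sum, Finset.powersetCard_eq_filter,
          Finset.powerset_univ]
    _ = ((d + 1) * d.choose (d / 2) : ℝ) * tracePart π Z := by
        rw [tracePart_eq]
        push_cast
        rw [mul_assoc, mul_div_cancel₀ _ (Nat.cast_ne_zero.2 (choose_half_pos d).ne')]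

theorem tracePart_im (hd : Even d) (π : Nat.Partition d) (Z : Matrix (Fin n) (Fin n) ℂ) :
    (tracePart π Z).im = 0 := by
  have hC : ((d + 1) * d.choose (d / 2) : ℝ) ≠ 0 := by
    have := choose_half_pos d
    positivity
  have him := congrArg Complex.im
    (sum_tracePart_twists hd (Complex.isPrimitiveRoot_exp (d + 1) d.succ_ne_zero) π Z)
  simp only [tracePart_herm_eq_psumPart, ← Complex.ofReal_sum, Complex.ofReal_im,
    Complex.im_ofReal_mul] at him
  exact (mul_eq_zero.1 him.symm).resolve_left hC

end Twist

section TracePolynomial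

theorem map_splitLengths {α β : Type*} (f : α → β) (sz : List ℕ) (w : List α) :
    sz.splitLengths (w.map f) = (sz.splitLengths w).map (List.map f) := by
  induction sz generalizing w with
  | nil => rfl
  | cons l sz ih => simp [List.splitLengths_cons, ← List.map_take, ← List.map_drop, ih]

variable {n d : ℕ}

/-- The polynomial in traces of words with value `T_π(Z)` at `Z`. -/
noncomputable def tracePartPolynomial (π : Nat.Partition d) : MvPolynomial (FreeMonoid Bool) ℝ :=
  MvPolynomial.C ((d.choose (d / 2) : ℝ)⁻¹) *
    ∑ S ∈ Finset.powersetCard (d / 2) (Finset.univ : Finset (Fin d)),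
      (((π.parts.sort (· ≥ ·)).splitLengths
        (List.ofFn fun i : Fin d => FreeMonoid.of (decide (i ∉ S)))).map
          fun w => MvPolynomial.X w.prod).prod

theorem map_evalWord_ofFn (Z : Matrix (Fin n) (Fin n) ℂ) (S : Finset (Fin d)) :
    (List.ofFn fun i => FreeMonoid.of (decide (i ∉ S))).map (evalWord Z) =
      List.ofFn (adjointWord Z S) := by
  rw [List.map_ofFn]
  congr 1
  ext i : 1
  by_cases hi : i ∈ S <;> simp [evalWord, adjointWord, hi]

theorem aeval_tracePartPolynomial (π : Nat.Partition d) (Z : Matrix (Fin n) (Fin n) ℂ) :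
    MvPolynomial.aeval (fun w => (evalWord Z w).trace) (tracePartPolynomial π) =
      tracePart π Z := by
  rw [tracePartPolynomial, map_mul, MvPolynomial.aeval_C, map_sum, tracePart_eq, div_eq_inv_mul]
  congr 1
  · simp
  · refine Finset.sum_congr rfl fun S _ => ?_
    change _ = blockTrace _ (List.ofFn (adjointWord Z S))
    rw [blockTrace, ← map_evalWord_ofFn, map_splitLengths, map_list_prod, List.map_map,
      List.map_map]
    congr 2
    ext w
    simp [map_list_prod]

theorem continuous_evalWord (w : FreeMonoid Bool) :
    Continuous fun Z : Matrix (Fin n) (Fin n) ℂ => evalWord Z w := by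
  simp only [evalWord, FreeMonoid.lift_apply]
  refine continuous_list_prod _ fun b _ => ?_
  cases b
  · simpa using continuous_id.matrix_conjTranspose
  · simpa using continuous_id'

theorem IsTracePolynomial.continuous {f : Matrix (Fin n) (Fin n) ℂ → ℝ}
    (hf : IsTracePolynomial f) : Continuous f := by
  obtain ⟨q, hq⟩ := hf
  have hre : f = fun Z => (MvPolynomial.aeval (fun w => (evalWord Z w).trace) q).re := by
    ext Z
    rw [← hq, Complex.ofReal_re]
  simp only [hre, MvPolynomial.aeval_def, MvPolynomial.eval₂_eq]
  refine Complex.continuous_re.comp (continuous_finsetSum _ fun e _ => continuous_const.mul ?_)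
  exact continuous_finsetProd _ fun w _ => (continuous_evalWord w).matrix_trace.pow _

end TracePolynomial

section MatrixNorm

variable {n d : ℕ} {κ : ℕ → ℝ} {ω : ℂ}

/-- `∑_{π ⊢ d} κ_π T_π(Z) / y_π`, of which `matNorm κ d Z` is the `d`th root. -/
noncomputable def traceSum (κ : ℕ → ℝ) (d : ℕ) (Z : Matrix (Fin n) (Fin n) ℂ) : ℝ :=
  ∑ π : Nat.Partition d, kappaPart κ π * (tracePart π Z).re / (yPart π : ℝ)

theorem matNorm_eq (κ : ℕ → ℝ) (d : ℕ) (Z : Matrix (Fin n) (Fin n) ℂ) :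
    matNorm κ d Z = traceSum κ d Z ^ (1 / (d : ℝ)) :=
  rfl

theorem traceSum_herm (κ : ℕ → ℝ) (d : ℕ) (A : Herm n) :
    traceSum κ d (A : Matrix (Fin n) (Fin n) ℂ) =
      ∑ π : Nat.Partition d, kappaPart κ π * psumPart π (eig A) / (yPart π : ℝ) := by
  simp only [traceSum, tracePart_herm_eq_psumPart, Complex.ofReal_re]

theorem traceSum_smul (hd : Even d) (κ : ℕ → ℝ) (c : ℂ) (Z : Matrix (Fin n) (Fin n) ℂ) :
    traceSum κ d (c • Z) = ‖c‖ ^ d * traceSum κ d Z := by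
  simp only [traceSum, tracePart_smul hd, Complex.re_ofReal_mul, mul_left_comm _ (‖c‖ ^ d),
    mul_div_assoc, Finset.mul_sum]

theorem isTracePolynomial_traceSum (hd : Even d) (κ : ℕ → ℝ) :
    IsTracePolynomial (traceSum κ d : Matrix (Fin n) (Fin n) ℂ → ℝ) := by
  refine ⟨∑ π : Nat.Partition d, MvPolynomial.C (kappaPart κ π / yPart π) * tracePartPolynomial π,
    fun Z => ?_⟩
  rw [map_sum, traceSum, Complex.ofReal_sum]
  refine Finset.sum_congr rfl fun π _ => ?_
  have hreal : ((tracePart π Z).re : ℂ) = tracePart π Z :=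
    Complex.ext (by simp) (by simp [tracePart_im hd])
  rw [map_mul, MvPolynomial.aeval_C, aeval_tracePartPolynomial, mul_div_right_comm,
    Complex.ofReal_mul, hreal]
  rfl

theorem traceSum_eq_average (hd : Even d) (hω : IsPrimitiveRoot ω (d + 1))
    (κ : ℕ → ℝ) (Z : Matrix (Fin n) (Fin n) ℂ) :
    traceSum κ d Z = (∑ k, traceSum κ d (twists d ω Z k : Matrix (Fin n) (Fin n) ℂ)) /
      ((d + 1) * d.choose (d / 2)) := by
  have hC : ((d + 1) * d.choose (d / 2) : ℝ) ≠ 0 := by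
    have := choose_half_pos d
    positivity
  have hre : ∀ π : Nat.Partition d,
      ∑ k, (tracePart π (twists d ω Z k : Matrix (Fin n) (Fin n) ℂ)).re =
        (d + 1) * d.choose (d / 2) * (tracePart π Z).re := fun π => by
    rw [← Complex.re_sum, sum_tracePart_twists hd hω, Complex.re_ofReal_mul]
  simp only [traceSum]
  rw [eq_div_iff hC, Finset.sum_comm, Finset.sum_mul]
  refine Finset.sum_congr rfl fun π _ => ?_
  rw [← Finset.sum_div, ← Finset.mul_sum, hre]
  ring

variable {h : Herm n → ℝ}

theorem traceSum_nonneg (hd : Even d) (hh : ∀ A, h A ^ d = traceSum κ d A.1)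
    (Z : Matrix (Fin n) (Fin n) ℂ) : 0 ≤ traceSum κ d Z := by
  rw [traceSum_eq_average hd (Complex.isPrimitiveRoot_exp (d + 1) d.succ_ne_zero)]
  simp only [← hh]
  exact div_nonneg (Finset.sum_nonneg fun k _ => hd.pow_nonneg _) (by positivity)

theorem matNorm_pow (hd : Even d) (hd0 : d ≠ 0) (hh : ∀ A, h A ^ d = traceSum κ d A.1)
    (Z : Matrix (Fin n) (Fin n) ℂ) : matNorm κ d Z ^ d = traceSum κ d Z := by
  rw [matNorm_eq, one_div, Real.rpow_inv_natCast_pow (traceSum_nonneg hd hh Z) hd0]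

theorem matNorm_herm (hN : IsNorm ℝ h) (hd0 : d ≠ 0) (hh : ∀ A, h A ^ d = traceSum κ d A.1)
    (A : Herm n) : matNorm κ d A.1 = h A := by
  rw [matNorm_eq, ← hh, one_div, Real.pow_rpow_inv_natCast (hN.nonneg A) hd0]

theorem matNorm_smul (hd : Even d) (hd0 : d ≠ 0) (hh : ∀ A, h A ^ d = traceSum κ d A.1)
    (c : ℂ) (Z : Matrix (Fin n) (Fin n) ℂ) : matNorm κ d (c • Z) = ‖c‖ * matNorm κ d Z := by
  rw [matNorm_eq, matNorm_eq, traceSum_smul hd,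
    Real.mul_rpow (by positivity) (traceSum_nonneg hd hh Z), one_div,
    Real.pow_rpow_inv_natCast (norm_nonneg c) hd0]

theorem matNorm_eq_lpSum_twists (hd : Even d) (hω : IsPrimitiveRoot ω (d + 1))
    (hh : ∀ A, h A ^ d = traceSum κ d A.1) (Z : Matrix (Fin n) (Fin n) ℂ) :
    matNorm κ d Z = (∑ k, h (twists d ω Z k) ^ (d : ℝ)) ^ (1 / (d : ℝ)) /
      ((d + 1) * d.choose (d / 2) : ℝ) ^ (1 / (d : ℝ)) := by
  simp only [Real.rpow_natCast]
  rw [matNorm_eq, traceSum_eq_average hd hω, Real.div_rpow _ (by positivity)]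
  · simp only [hh]
  · simp only [← hh]
    exact Finset.sum_nonneg fun k _ => hd.pow_nonneg _

theorem isNorm_matNorm (hN : IsNorm ℝ h) (hd : Even d) (hd0 : d ≠ 0)
    (hh : ∀ A, h A ^ d = traceSum κ d A.1) :
    IsNorm ℂ fun Z : Matrix (Fin n) (Fin n) ℂ => matNorm κ d Z := by
  have hω := Complex.isPrimitiveRoot_exp (d + 1) d.succ_ne_zero
  have hd1 : (1 : ℝ) ≤ d := Nat.one_le_cast.2 (Nat.one_le_iff_ne_zero.2 hd0)
  have hC : (0 : ℝ) < ((d + 1) * d.choose (d / 2) : ℝ) ^ (1 / (d : ℝ)) := by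
    have := choose_half_pos d
    positivity
  have hd2 : 2 ≤ d := Nat.le_of_dvd (Nat.pos_of_ne_zero hd0) hd.two_dvd
  have hreal : IsNorm ℝ fun Z : Matrix (Fin n) (Fin n) ℂ => matNorm κ d Z := by
    rw [funext (matNorm_eq_lpSum_twists hd hω hh)]
    exact ((hN.lpSum hd1).comp_injective (twists_injective hω hd2)).div_const hC
  exact { hreal with smul := matNorm_smul hd hd0 hh }

theorem isTracePolynomial_matNorm_pow (hd : Even d) (hd0 : d ≠ 0)
    (hh : ∀ A, h A ^ d = traceSum κ d A.1) :
    IsTracePolynomial fun Z : Matrix (Fin n) (Fin n) ℂ => matNorm κ d Z ^ d := by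
  simpa only [matNorm_pow hd hd0 hh] using isTracePolynomial_traceSum hd κ

end MatrixNorm

end RandomNorm

open RandomNorm in
theorem theorem1_general {Ω : Type*} [MeasurableSpace Ω] (P : Measure Ω) [IsProbabilityMeasure P]
    (n : ℕ) [NeZero n] (X : Fin n → Ω → ℝ) (d : ℝ) (hd : 1 ≤ d)
    (hLd : ∀ i, MemLp (X i) (ENNReal.ofReal d) P)
    (hnondeg : ∀ i, ∀ c : ℝ, ¬ (X i =ᵐ[P] fun _ => c))
    (hindep : iIndepFun X P)
    (hident : ∀ i j, IdentDistrib (X i) (X j) P P) :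
    ((∀ A : Herm n,
        Integrable (fun ω => |pairing X (eig A) ω| ^ d) P) ∧
      IsNorm ℝ (hermNorm P X d)) ∧
    (∀ m : ℕ, Even m → (m : ℝ) = d → 0 ∈ interior (integrableExpSet (X 0) P) →
      (∀ A : Herm n,
        0 ∈ interior (integrableExpSet (pairing X (eig A)) P) ∧
        (∀ t : ℝ, mgf (pairing X (eig A)) P t =
          ∏ i, mgf (X 0) P (eig A i * t)) ∧
        HasPowerSeriesCoeff
          (fun t => ∏ i, mgf (X 0) P (eig A i * t)) m
          (hermNorm P X d A ^ m)) ∧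
      ∃ p : MvPolynomial (Fin n) ℝ, p.IsSymmetric ∧ p.IsHomogeneous m ∧
        IsPositiveDefinite (fun x : Fin n → ℝ => MvPolynomial.eval x p) ∧
        ∀ A : Herm n,
          hermNorm P X d A ^ m = MvPolynomial.eval (eig A) p) ∧
    (∀ m : ℕ, Even m → (m : ℝ) = d → ∀ A : Herm n,
      ((hermNorm P X d A ^ m : ℝ) : ℂ) =
        1 / (m ! : ℂ) * bell m (fun j =>
          (cumulant P (X 0) j : ℂ) *
            ((A : Matrix (Fin n) (Fin n) ℂ) ^ j).trace) ∧
      (∀ π : Nat.Partition m, (psumPart π (eig A) : ℂ) =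
        (π.parts.map fun k => ((A : Matrix (Fin n) (Fin n) ℂ) ^ k).trace).prod) ∧
      hermNorm P X d A ^ m =
        ∑ π : Nat.Partition m, kappaPart (cumulant P (X 0)) π *
          psumPart π (eig A) / (yPart π : ℝ)) ∧
    (SchurConvex (vecNorm P X d) ∧
      ∀ A B : Herm n,
        Majorizes (eig B) (eig A) →
          hermNorm P X d A ≤ hermNorm P X d B) ∧
    (∀ m : ℕ, Even m → (m : ℝ) = d →
      (∀ (π : Nat.Partition m) (Z : Matrix (Fin n) (Fin n) ℂ),
        (tracePart π Z).im = 0) ∧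
      IsNorm ℂ
        (fun Z : Matrix (Fin n) (Fin n) ℂ =>
          matNorm (cumulant P (X 0)) m Z) ∧
      (∀ A : Herm n,
        matNorm (cumulant P (X 0)) m (A : Matrix (Fin n) (Fin n) ℂ) =
          hermNorm P X d A) ∧
      (∀ Z : Matrix (Fin n) (Fin n) ℂ,
        matNorm (cumulant P (X 0)) m Z ^ m =
          ∑ π : Nat.Partition m, kappaPart (cumulant P (X 0)) π *
            (tracePart π Z).re / (yPart π : ℝ)) ∧
      IsPositiveDefinite
        (fun Z : Matrix (Fin n) (Fin n) ℂ =>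
          matNorm (cumulant P (X 0)) m Z ^ m) ∧
      IsTracePolynomial
        (fun Z : Matrix (Fin n) (Fin n) ℂ =>
          matNorm (cumulant P (X 0)) m Z ^ m)) := by
  have hN := isNorm_vecNorm hd hLd hnondeg hindep
  have hperm := isPermInvariant_vecNorm hindep hident d
  have hH : IsNorm ℝ (hermNorm P X d) := hN.comp_eig hperm
  have hschur := hN.schurConvex hperm
  have hident₀ := fun i => hident i 0
  have hne : ∀ m : ℕ, (m : ℝ) = d → m ≠ 0 := by
    rintro m rfl rfl
    norm_num at hd
  have hLm : ∀ m : ℕ, (m : ℝ) = d → ∀ i, MemLp (X i) m P := by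
    rintro m rfl
    simpa using hLd
  have hsum : ∀ m : ℕ, Even m → (m : ℝ) = d → ∀ x, vecNorm P X d x ^ m =
      ∑ π : Nat.Partition m, kappaPart (cumulant P (X 0)) π * psumPart π x / (yPart π : ℝ) := by
    rintro m hm rfl
    exact vecNorm_pow_eq_sum_partition hm (hne m rfl) (hLm m rfl) hindep hident₀
  refine ⟨⟨fun A => integrable_abs_pairing_rpow (by linarith) hLd _, hH⟩, ?_, ?_,
    ⟨hschur, fun A B => hschur _ _⟩, ?_⟩ <;> rintro m hm rfl
  · intro hexp
    obtain ⟨p, hsymm, hhom, hpos, hp⟩ := hN.exists_mvPolynomial (hsum m hm rfl)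
    exact ⟨fun A => ⟨zero_mem_interior_integrableExpSet_pairing hindep hident₀ hexp (eig A),
      mgf_pairing hindep hident₀ (eig A),
      hasPowerSeriesCoeff_prod_mgf hm (hne m rfl) hindep hident₀ hexp (eig A)⟩,
      p, hsymm, hhom, hpos, fun A => hp (eig A)⟩
  · exact fun A => ⟨hermNorm_pow_eq_bell_trace hm (hne m rfl) (hLm m rfl) hindep hident₀ A,
      fun π => psumPart_eig π A, hsum m hm rfl (eig A)⟩
  · have htrace : ∀ A, hermNorm P X m A ^ m = traceSum (cumulant P (X 0)) m A.1 := fun A =>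
      (hsum m hm rfl (eig A)).trans (traceSum_herm _ m A).symm
    have hM := isNorm_matNorm hH hm (hne m rfl) htrace
    have hpoly := isTracePolynomial_matNorm_pow hm (hne m rfl) htrace
    exact ⟨tracePart_im hm, hM, matNorm_herm hH (hne m rfl) htrace,
      matNorm_pow hm (hne m rfl) htrace, hM.isPositiveDefinite_pow hpoly.continuous, hpoly⟩

theorem theorem1 {Ω : Type*} [MeasurableSpace Ω] (P : Measure Ω) [IsProbabilityMeasure P]
    (n : ℕ) [NeZero n] (X : Fin n → Ω → ℝ) (d : ℝ) (hd : 2 ≤ d)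
    (hmeas : ∀ i, Measurable (X i))
    (hLd : ∀ i, MemLp (X i) (ENNReal.ofReal d) P)
    (hnondeg : ∀ i, ∀ c : ℝ, ¬ (X i =ᵐ[P] fun _ => c))
    (hindep : iIndepFun X P)
    (hident : ∀ i j, IdentDistrib (X i) (X j) P P) :
    -- (a)
    ((∀ A : RandomNorm.Herm n,
        Integrable (fun ω => |RandomNorm.pairing X (RandomNorm.eig A) ω| ^ d) P) ∧
      RandomNorm.IsNorm ℝ (RandomNorm.hermNorm P X d)) ∧
    -- (b)
    (∀ m : ℕ, Even m → (m : ℝ) = d → 0 ∈ interior (integrableExpSet (X 0) P) →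
      (∀ A : RandomNorm.Herm n,
        0 ∈ interior (integrableExpSet (RandomNorm.pairing X (RandomNorm.eig A)) P) ∧
        (∀ t : ℝ, mgf (RandomNorm.pairing X (RandomNorm.eig A)) P t =
          ∏ i, mgf (X 0) P (RandomNorm.eig A i * t)) ∧
        RandomNorm.HasPowerSeriesCoeff
          (fun t => ∏ i, mgf (X 0) P (RandomNorm.eig A i * t)) m
          (RandomNorm.hermNorm P X d A ^ m)) ∧
      ∃ p : MvPolynomial (Fin n) ℝ, p.IsSymmetric ∧ p.IsHomogeneous m ∧
        RandomNorm.IsPositiveDefinite (fun x : Fin n → ℝ => MvPolynomial.eval x p) ∧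
        ∀ A : RandomNorm.Herm n,
          RandomNorm.hermNorm P X d A ^ m = MvPolynomial.eval (RandomNorm.eig A) p) ∧
    -- (c)
    (∀ m : ℕ, Even m → (m : ℝ) = d → ∀ A : RandomNorm.Herm n,
      ((RandomNorm.hermNorm P X d A ^ m : ℝ) : ℂ) =
        1 / (m ! : ℂ) * RandomNorm.bell m (fun j =>
          (RandomNorm.cumulant P (X 0) j : ℂ) *
            ((A : Matrix (Fin n) (Fin n) ℂ) ^ j).trace) ∧
      (∀ π : Nat.Partition m, (RandomNorm.psumPart π (RandomNorm.eig A) : ℂ) =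
        (π.parts.map fun k => ((A : Matrix (Fin n) (Fin n) ℂ) ^ k).trace).prod) ∧
      RandomNorm.hermNorm P X d A ^ m =
        ∑ π : Nat.Partition m, RandomNorm.kappaPart (RandomNorm.cumulant P (X 0)) π *
          RandomNorm.psumPart π (RandomNorm.eig A) / (RandomNorm.yPart π : ℝ)) ∧
    -- (d)
    (RandomNorm.SchurConvex (RandomNorm.vecNorm P X d) ∧
      ∀ A B : RandomNorm.Herm n,
        RandomNorm.Majorizes (RandomNorm.eig B) (RandomNorm.eig A) →
          RandomNorm.hermNorm P X d A ≤ RandomNorm.hermNorm P X d B) ∧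
    -- (e)
    (∀ m : ℕ, Even m → (m : ℝ) = d →
      (∀ (π : Nat.Partition m) (Z : Matrix (Fin n) (Fin n) ℂ),
        (RandomNorm.tracePart π Z).im = 0) ∧
      RandomNorm.IsNorm ℂ
        (fun Z : Matrix (Fin n) (Fin n) ℂ =>
          RandomNorm.matNorm (RandomNorm.cumulant P (X 0)) m Z) ∧
      (∀ A : RandomNorm.Herm n,
        RandomNorm.matNorm (RandomNorm.cumulant P (X 0)) m (A : Matrix (Fin n) (Fin n) ℂ) =
          RandomNorm.hermNorm P X d A) ∧
      (∀ Z : Matrix (Fin n) (Fin n) ℂ,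
        RandomNorm.matNorm (RandomNorm.cumulant P (X 0)) m Z ^ m =
          ∑ π : Nat.Partition m, RandomNorm.kappaPart (RandomNorm.cumulant P (X 0)) π *
            (RandomNorm.tracePart π Z).re / (RandomNorm.yPart π : ℝ)) ∧
      RandomNorm.IsPositiveDefinite
        (fun Z : Matrix (Fin n) (Fin n) ℂ =>
          RandomNorm.matNorm (RandomNorm.cumulant P (X 0)) m Z ^ m) ∧
      RandomNorm.IsTracePolynomial
        (fun Z : Matrix (Fin n) (Fin n) ℂ =>
          RandomNorm.matNorm (RandomNorm.cumulant P (X 0)) m Z ^ m)) := by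
  exact theorem1_general P n X d (by linarith) hLd hnondeg hindep hident
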